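/- **Corollary (quantum memory speedup).** For an integer $m\ge 2$ put $d=m^2$ and consider the bipartite system $\mathcal H_A\otimes\mathcal H_B$ with $\mathcal H_A=\mathcal H_B=\mathbb C^m$. Let $\pi^*_{d,1}$ be the following law of a random state $\rho$: with probability $\frac12$, $\rho=|\psi\rangle\langle\psi|$ for a Haar random pure state $|\psi\rangle=U|0\rangle\in\mathcal H_A\otimes\mathcal H_B$, and with probability $\frac12$, $\rho=|\psi_A\rangle\langle\psi_A|\otimes|\psi_B\rangle\langle\psi_B|$ for independent Haar random pure states $|\psi_A\rangle,|\psi_B\rangle\in\mathbb C^m$. A state is entangled ($\rho\in\mathrm{ENT}$) if it is not a finite convex combination of product states $\rho_A\otimes\rho_B$. An entanglement detection protocol receives copies of $\rho\sim\pi^*_{d,1}$, computes a real number $\hat C(\rho)$ from its measurement data, and declares "entangled" if $\hat C(\rho)<0$. Its completeness is $\Pr[\hat C(\rho)<0]$ and its soundness is $\Pr[\rho\in\mathrm{ENT}\mid\hat C(\rho)<0]$. A protocol with quantum memory on $T$ copies performs a joint (finite-outcome) POVM on $\rho^{\otimes T}$. An adaptive single-copy protocol with at most $T$ copies is a decision tree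 of depth at most $T$: in each step one fresh copy of $\rho$ is measured by a finite-outcome POVM that may depend on all earlier outcomes, and $\hat C$ is a function of the leaf that is reached. The SWAP-test protocol on $2N$ copies measures, on each of $N$ disjoint pairs of copies, the operator $S_A$ that swaps the two copies of subsystem $A$ (effects $(\mathbb 1\pm S_A)/2$), with outcomes $s_1,\dots,s_N\in\{\pm1\}$, and uses $\hat C=\frac1N\sum_{j}s_j-1$, an estimate of $\operatorname{Tr}(\rho_A^2)-\operatorname{Tr}(\rho^2)$ for pure $\rho$. Then quantum memory gives an exponential (in the number $\log_2 d$ of qubits) speedup in sample complexity: 1. ($O(1)$ copies suffice with memory.) There is a number $N$, independent of $m$, such that for every $m\ge2$ the SWAP-test protocol on $2N$ copies has completeness at least $\frac14$ and soundness at least $\frac56$; moreover some protocol with quantum memory on $2N$ copies has completeness exactly $\frac14$ and soundness exactly $\frac56$. 2. ($\Omega(d^{1/4})$ copies are necessary without memory.) There is a constant $c>0$, independent of $m$, such that for every $m\ge2$ and every $T$, each adaptive single-copy protocol that uses at most $T$ copies and has completeness at least $\frac14$ and soundness at least $\frac56$ (in particular, each one with completeness $\frac14$ and soundness $\frac56$)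 satisfies $T\ge c\,d^{1/4}$. -/

import Mathlib

open MeasureTheory Matrix
open scoped ComplexOrder Kronecker ENNReal

namespace EDP

/-! ### States, separability and entanglement -/

/-- Density matrices: positive semidefinite with unit trace. -/
def IsDensity {ι : Type} [Fintype ι] (ρ : Matrix ι ι ℂ) : Prop :=
  ρ.PosSemidef ∧ ρ.trace = 1

/-- A bipartite state is separable if it is a finite convex combination of products of states. -/
def IsSeparable {A B : Type} [Fintype A] [Fintype B] (ρ : Matrix (A × B) (A × B) ℂ) : Prop :=
  ∃ (k : ℕ) (p : Fin k → ℝ) (ρA : Fin k → Matrix A A ℂ) (ρB : Fin k → Matrix B B ℂ),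
    (∀ i, 0 ≤ p i) ∧ ∑ i, p i = 1 ∧ (∀ i, IsDensity (ρA i)) ∧ (∀ i, IsDensity (ρB i)) ∧
      ρ = ∑ i, (p i : ℂ) • (ρA i ⊗ₖ ρB i)

/-- The set ENT of entangled states: the states that are not separable. -/
def entangled (A B : Type) [Fintype A] [Fintype B] : Set (Matrix (A × B) (A × B) ℂ) :=
  {ρ | IsDensity ρ ∧ ¬ IsSeparable ρ}

/-! ### Haar random states -/

/-- Complex matrices carry the Borel sigma-algebra. -/
noncomputable instance instMeasurableSpaceMatrix {ι κ : Type} : MeasurableSpace (Matrix ι κ ℂ) := borel _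

instance instBorelSpaceMatrix {ι κ : Type} : BorelSpace (Matrix ι κ ℂ) := ⟨rfl⟩

theorem isCompact_unitaryGroup (ι : Type) [Fintype ι] [DecidableEq ι] :
    IsCompact (Matrix.unitaryGroup ι ℂ : Set (Matrix ι ι ℂ)) := by
  have hK : IsCompact (Set.univ.pi fun _ : ι => Set.univ.pi fun _ : ι =>
      Metric.closedBall (0 : ℂ) 1) :=
    isCompact_univ_pi fun _ => isCompact_univ_pi fun _ => isCompact_closedBall 0 1
  have hK' : IsCompact {M : Matrix ι ι ℂ | ∀ i j, M i j ∈ Metric.closedBall (0 : ℂ) 1} := by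
    have h : {M : ι → ι → ℂ | ∀ i j, M i j ∈ Metric.closedBall (0 : ℂ) 1} =
        Set.univ.pi fun _ : ι => Set.univ.pi fun _ : ι => Metric.closedBall (0 : ℂ) 1 := by
      ext M
      simp only [Set.mem_ofPred_eq, Set.mem_pi, Set.mem_univ, true_implies]
    exact h ▸ hK
  refine hK'.of_isClosed_subset ?_ ?_
  · exact isClosed_unitary
  · intro U hU i j
    simpa using entry_norm_bound_of_unitary hU i j

instance instCompactSpaceUnitaryGroup (ι : Type) [Fintype ι] [DecidableEq ι] :
    CompactSpace (Matrix.unitaryGroup ι ℂ) :=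
  isCompact_iff_compactSpace.mp (isCompact_unitaryGroup ι)

/-- The Haar probability measure on the unitary group. -/
noncomputable def haarUnitary (ι : Type) [Fintype ι] [DecidableEq ι] :
    Measure (Matrix.unitaryGroup ι ℂ) :=
  Measure.haarMeasure ⊤

/-- The density matrix `|ψ⟩⟨ψ|`. -/
noncomputable def ketbra {ι : Type} (ψ : ι → ℂ) : Matrix ι ι ℂ := vecMulVec ψ (star ψ)

/-- The law of `|ψ⟩⟨ψ|` for a Haar random pure state `ψ = U |0⟩`,
where `U` is Haar distributed and `|0⟩` is a fixed basis vector. -/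
noncomputable def haarState (ι : Type) [Fintype ι] [DecidableEq ι] [Nonempty ι] :
    Measure (Matrix ι ι ℂ) :=
  (haarUnitary ι).map fun U : Matrix.unitaryGroup ι ℂ =>
    ketbra ((U : Matrix ι ι ℂ) *ᵥ Pi.single (Classical.arbitrary ι) 1)

/-- The law of `ρA ⊗ ρB` for two independent Haar random pure states. -/
noncomputable def haarProductState (A B : Type) [Fintype A] [DecidableEq A] [Nonempty A]
    [Fintype B] [DecidableEq B] [Nonempty B] : Measure (Matrix (A × B) (A × B) ℂ) :=
  ((haarState A).prod (haarState B)).map fun x => x.1 ⊗ₖ x.2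

/-- The law of the unknown state, with local dimension `m` and total dimension `d = m ^ 2`:
with probability one half a Haar random pure state of the whole system, with probability one half
a product of two independent Haar random local pure states. -/
noncomputable def taskLaw (m : ℕ) [NeZero m] :
    Measure (Matrix (Fin m × Fin m) (Fin m × Fin m) ℂ) :=
  (2⁻¹ : ℝ≥0∞) • haarState (Fin m × Fin m) + (2⁻¹ : ℝ≥0∞) • haarProductState (Fin m) (Fin m)

/-! ### Measurements and protocols -/

/-- Measurements with outcome set `Ω` on the Hilbert space with basis `ι`. -/
structure POVM (ι Ω : Type) [Fintype ι] [DecidableEq ι] [Fintype Ω] where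
  effect : Ω → Matrix ι ι ℂ
  posSemidef : ∀ ω, (effect ω).PosSemidef
  sum_effect : ∑ ω, effect ω = 1

/-- Born rule. -/
noncomputable def POVM.prob {ι Ω : Type} [Fintype ι] [DecidableEq ι] [Fintype Ω]
    (M : POVM ι Ω) (ρ : Matrix ι ι ℂ) (ω : Ω) : ℝ :=
  (M.effect ω * ρ).trace.re

/-- The state `ρ^{⊗ T}` of `T` copies of `ρ`. -/
noncomputable def tensorPower {ι : Type} (ρ : Matrix ι ι ℂ) (T : ℕ) : Matrix (Fin T → ι) (Fin T → ι) ℂ :=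
  Matrix.of fun x y => ∏ t, ρ (x t) (y t)

/-- A protocol with quantum memory on `T` copies: a joint measurement of all `T` copies, and an
estimator (a real number computed from the data); "entangled" is declared when the estimator is
negative. -/
structure JointProtocol (ι : Type) [Fintype ι] [DecidableEq ι] (T : ℕ) where
  Outcome : Type
  [fintypeOutcome : Fintype Outcome]
  povm : POVM (Fin T → ι) Outcome
  estimator : Outcome → ℝ

attribute [instance] JointProtocol.fintypeOutcome

/-- The probability that the protocol declares "entangled" on copies of `ρ`. -/
noncomputable def JointProtocol.detectProb {ι : Type} [Fintype ι] [DecidableEq ι] {T : ℕ}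
    (P : JointProtocol ι T) (ρ : Matrix ι ι ℂ) : ℝ :=
  ∑ ω, if P.estimator ω < 0 then P.povm.prob (tensorPower ρ T) ω else 0

/-- Adaptive single-copy protocols that use at most `T` copies: decision trees in which each step
consumes one fresh copy by a measurement that may depend on all earlier outcomes; at a leaf the
value of the estimator is output. -/
inductive SingleCopyProtocol (ι : Type) [Fintype ι] [DecidableEq ι] : ℕ → Type 1
  | output {T : ℕ} (value : ℝ) : SingleCopyProtocol ι T
  | measure {T : ℕ} {Ω : Type} [Fintype Ω] (M : POVM ι Ω)
      (next : Ω → SingleCopyProtocol ι T) : SingleCopyProtocol ι (T + 1)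

/-- The probability that the protocol declares "entangled" (negative output) on copies of `ρ`. -/
noncomputable def SingleCopyProtocol.detectProb {ι : Type} [Fintype ι] [DecidableEq ι]
    {T : ℕ} : SingleCopyProtocol ι T → Matrix ι ι ℂ → ℝ
  | .output value, _ => if value < 0 then 1 else 0
  | @SingleCopyProtocol.measure _ _ _ _ Ω _ M next, ρ => ∑ ω : Ω, M.prob ρ ω * (next ω).detectProb ρ

/-- The probability of declaring "entangled", for a state drawn from `π` and a protocol that
declares "entangled" on `ρ` with probability `p ρ`. -/
noncomputable def completeness {A B : Type} (π : Measure (Matrix (A × B) (A × B) ℂ))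
    (p : Matrix (A × B) (A × B) ℂ → ℝ) : ℝ :=
  ∫ ρ, p ρ ∂π

/-- The conditional probability that the state is entangled given that "entangled" is declared. -/
noncomputable def soundness {A B : Type} [Fintype A] [Fintype B]
    (π : Measure (Matrix (A × B) (A × B) ℂ)) (p : Matrix (A × B) (A × B) ℂ → ℝ) : ℝ :=
  (∫ ρ in entangled A B, p ρ ∂π) / ∫ ρ, p ρ ∂π

/-! ### The SWAP test for the purity of the first subsystem -/

/-- The unitary on two copies of a bipartite system that swaps the two copies of `A`. -/
noncomputable def swapA (A B : Type) [DecidableEq A] [DecidableEq B] :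
    Matrix ((A × B) × (A × B)) ((A × B) × (A × B)) ℂ :=
  Matrix.of fun x y => if x = ((y.2.1, y.1.2), (y.1.1, y.2.2)) then 1 else 0

/-- The sign of an outcome of the SWAP test. -/
noncomputable def sign (b : Bool) : ℝ := if b then 1 else -1

/-- The two effects `(1 ± S_A) / 2` of the SWAP test. -/
noncomputable def swapEffect (A B : Type) [DecidableEq A] [DecidableEq B] (b : Bool) :
    Matrix ((A × B) × (A × B)) ((A × B) × (A × B)) ℂ :=
  (2⁻¹ : ℂ) • (1 + (sign b : ℂ) • swapA A B)

/-- The `j`-th pair of copies among `N` consecutive pairs. -/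
def pair {ι : Type} {N : ℕ} (j : Fin N) (x : Fin (N * 2) → ι) : ι × ι :=
  (x (finProdFinEquiv (j, 0)), x (finProdFinEquiv (j, 1)))

theorem pair_ext {ι : Type} {N : ℕ} {x y : Fin (N * 2) → ι} :
    (∀ j, pair j x = pair j y) ↔ x = y := by
  refine ⟨fun h => ?_, fun h j => by rw [h]⟩
  funext c
  obtain ⟨⟨j, b⟩, rfl⟩ := finProdFinEquiv.surjective c
  have hj := h j
  simp only [pair, Prod.mk.injEq] at hj
  fin_cases b
  · exact hj.1
  · exact hj.2

/-- Splitting the copies into pairs. -/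
def pairEquiv (ι : Type) (N : ℕ) : (Fin (N * 2) → ι) ≃ (Fin N → ι × ι) where
  toFun x j := pair j x
  invFun y c := if (finProdFinEquiv.symm c).2 = 0 then (y (finProdFinEquiv.symm c).1).1
    else (y (finProdFinEquiv.symm c).1).2
  left_inv x := by
    refine pair_ext.mp fun j => ?_
    simp [pair]
  right_inv y := by
    funext j
    simp [pair]

section

variable {A B : Type} [DecidableEq A] [DecidableEq B]

theorem swapA_mul_self [Fintype A] [Fintype B] : swapA A B * swapA A B = 1 := by
  ext x y
  simp only [swapA, Matrix.mul_apply, Matrix.of_apply, Matrix.one_apply]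
  rw [Finset.sum_eq_single ((y.2.1, y.1.2), (y.1.1, y.2.2))] <;> simp +contextual

theorem swapA_conjTranspose : (swapA A B)ᴴ = swapA A B := by
  ext ⟨⟨a, b⟩, ⟨c, d⟩⟩ ⟨⟨a', b'⟩, ⟨c', d'⟩⟩
  simp only [swapA, Matrix.conjTranspose_apply, Matrix.of_apply, Prod.mk.injEq, apply_ite star,
    star_one, star_zero]
  congr 1
  simp only [eq_iff_iff]
  constructor <;> rintro ⟨⟨rfl, rfl⟩, rfl, rfl⟩ <;> simp

theorem swapEffect_conjTranspose (b : Bool) : (swapEffect A B b)ᴴ = swapEffect A B b := by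
  simp [swapEffect, Matrix.conjTranspose_smul, swapA_conjTranspose]

theorem swapEffect_mul_self [Fintype A] [Fintype B] (b : Bool) :
    swapEffect A B b * swapEffect A B b = swapEffect A B b := by
  have h : (sign b : ℂ) * (sign b : ℂ) = 1 := by cases b <;> simp [sign]
  simp only [swapEffect, Matrix.smul_mul, Matrix.mul_smul, Matrix.add_mul, Matrix.mul_add,
    Matrix.one_mul, Matrix.mul_one, swapA_mul_self, smul_add, smul_smul, ← mul_assoc]
  have h4 : (2⁻¹ * sign b * 2⁻¹ * sign b : ℂ) = 4⁻¹ := by linear_combination (4⁻¹ : ℂ) * h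
  rw [h4]
  module

theorem sum_swapEffect : ∑ b, swapEffect A B b = 1 := by
  simp only [Fintype.sum_bool, swapEffect, sign]
  simp only [if_true, Bool.false_eq_true, if_false, Complex.ofReal_neg, Complex.ofReal_one]
  module

end

/-- The joint measurement of `N` pairs of copies by independent SWAP tests on the first subsystem;
the outcome records the `N` results. Its effects are the tensor products of the `N` effects. -/
noncomputable def swapTestPOVM (A B : Type) [Fintype A] [Fintype B] [DecidableEq A] [DecidableEq B]
    (N : ℕ) : POVM (Fin (N * 2) → A × B) (Fin N → Bool) where
  effect s := Matrix.of fun x y => ∏ j, swapEffect A B (s j) (pair j x) (pair j y)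
  posSemidef s := by
    set E : Matrix (Fin (N * 2) → A × B) (Fin (N * 2) → A × B) ℂ :=
      Matrix.of fun x y => ∏ j, swapEffect A B (s j) (pair j x) (pair j y) with hE
    have h : E = Eᴴ * E := by
      ext x y
      simp only [hE, Matrix.mul_apply, Matrix.conjTranspose_apply, Matrix.of_apply, star_prod,
        ← Finset.prod_mul_distrib]
      have e : ∀ F : Fin N → (A × B) × (A × B) → ℂ,
          ∑ z : Fin (N * 2) → A × B, ∏ j, F j (pair j z) = ∏ j, ∑ w, F j w := by
        intro F
        rw [Fintype.prod_sum]
        exact Fintype.sum_equiv (pairEquiv (A × B) N) _ _ fun _ => rfl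
      rw [e fun j w =>
        star (swapEffect A B (s j) w (pair j x)) * swapEffect A B (s j) w (pair j y)]
      refine Finset.prod_congr rfl fun j _ => ?_
      have hq : swapEffect A B (s j) =
          (swapEffect A B (s j))ᴴ * swapEffect A B (s j) := by
        rw [swapEffect_conjTranspose, swapEffect_mul_self]
      exact congrFun (congrFun hq (pair j x)) (pair j y)
    rw [h]
    exact Matrix.posSemidef_conjTranspose_mul_self E
  sum_effect := by
    ext x y
    simp only [Matrix.sum_apply, Matrix.of_apply]
    rw [← Fintype.prod_sum fun (j : Fin N) (b : Bool) => swapEffect A B b (pair j x) (pair j y)]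
    simp only [← Matrix.sum_apply, sum_swapEffect, Matrix.one_apply]
    rw [Finset.prod_ite_zero]
    simp [pair_ext]

/-- The SWAP-test protocol on `2 N` copies. The average of the `N` signs estimates `Tr (ρ_A ^ 2)`;
subtracting `1`, which is `Tr (ρ ^ 2)` for pure states, gives the estimator of the purity
criterion `Tr (ρ_A ^ 2) - Tr (ρ ^ 2)`. -/
noncomputable def swapTestProtocol (A B : Type) [Fintype A] [Fintype B] [DecidableEq A]
    [DecidableEq B] (N : ℕ) : JointProtocol (A × B) (N * 2) where
  Outcome := Fin N → Bool
  povm := swapTestPOVM A B N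
  estimator s := (∑ j, sign (s j)) / N - 1

end EDP

/-! Both halves rest on one piece of calculus for a Haar random unit vector z in ℂⁿ, with ⟨f, g⟩ =
E[f(z) conj(g(z))] on polynomials. Differentiating unitary invariance shows that the adjoint of X_j
∂_i is X_i ∂_j. Inserting Σ|z_j|² = 1 then yields (n + k)⟨X_i f, g⟩ = ⟨f, ∂_i g⟩ for f homogeneous
of degree k (`IsSphericalBlock.polyInner_X_mul`). No Weingarten calculus or symmetric-subspace
projector is needed.

Without memory: factor every effect as R*R. The probability of a path in the decision tree is then a
sum of means of squared moduli of products of forms in the amplitudes, one form per copy and per row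
v of R. In the maximally mixed state such a row contributes ‖v‖²/m². By
`IsSphericalBlock.le_polyInner_linear_mul` (Haar law) and `le_polyInner_bilinear_mul` (product law),
multiplying a polynomial of degree k by the form multiplies the mean squared modulus by at least
‖v‖²/(m + k)². So under either law every verdict is at least ∏_{t<T} (m/(m + t))² ≥ 1 - T²/m times
as likely as in the maximally mixed state. Using this for the protocol on the product law and for
its complement on the Haar law, the two detection probabilities differ by at most T²/m in the
direction that matters, while the required completeness and soundness force a gap of 1/3. Hence T is
at least a constant times √m = d^(1/4).

With memory: on a pure state ψ one SWAP test gives +1 with probability (1 + Tr ρ_A²)/2 = 1 - w,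
where 4w = `minorSum ψ` sums the squared moduli of the two by two minors of the coefficient matrix.
So N tests flag ψ with probability 1 - (1 - w)^N. Minors vanish on separable pure states, so there
are no false alarms and the soundness is 1. It remains to find N independent of m with E(1 - w)^N ≤
1/2 under the Haar law. For m ≥ 3 convexity, w ≤ (1 - 1/m)/2 and the exact value of E w suffice. For
m = 2 the mean alone is too weak, and a quadratic majorant with the second moment of |det|² is used.
The exact values 1/4 and 5/6 come from mixing the verdict with constant verdicts. -/

namespace EDP

open MvPolynomial ComplexConjugate

/-! ### Polynomials in a random vector, and unitary invariance in infinitesimal form -/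

section PolyInner

variable {Ω σ ι : Type} [MeasurableSpace Ω] {μ : Measure Ω} {z : Ω → σ → ℂ}

/-- The sesquilinear form `E[f(z) conj(g(z))]` on polynomials in a random vector `z`. -/
noncomputable def polyInner (μ : Measure Ω) (z : Ω → σ → ℂ) (f g : MvPolynomial σ ℂ) : ℂ :=
  ∫ ω, eval (z ω) f * conj (eval (z ω) g) ∂μ

/-- All functions `f(z) conj(g(z))` are integrable. -/
def PolyIntegrable (μ : Measure Ω) (z : Ω → σ → ℂ) : Prop :=
  ∀ f g : MvPolynomial σ ℂ, Integrable (fun ω => eval (z ω) f * conj (eval (z ω) g)) μ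

theorem polyInner_add_left (hz : PolyIntegrable μ z) (f g h : MvPolynomial σ ℂ) :
    polyInner μ z (f + g) h = polyInner μ z f h + polyInner μ z g h := by
  simp only [polyInner, map_add, add_mul]
  exact integral_add (hz f h) (hz g h)

theorem polyInner_C_mul_left (c : ℂ) (f h : MvPolynomial σ ℂ) :
    polyInner μ z (C c * f) h = c * polyInner μ z f h := by
  simp only [polyInner, map_mul, eval_C, mul_assoc]
  exact integral_const_mul _ _

theorem conj_polyInner (f g : MvPolynomial σ ℂ) :
    conj (polyInner μ z f g) = polyInner μ z g f := by
  simp only [polyInner]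
  rw [← integral_conj]
  simp [mul_comm]

theorem polyInner_C_mul_right (c : ℂ) (f h : MvPolynomial σ ℂ) :
    polyInner μ z f (C c * h) = conj c * polyInner μ z f h := by
  rw [← conj_polyInner, polyInner_C_mul_left, map_mul, conj_polyInner]

theorem polyInner_zero_left (h : MvPolynomial σ ℂ) : polyInner μ z 0 h = 0 := by
  simp [polyInner]

theorem polyInner_zero_right (h : MvPolynomial σ ℂ) : polyInner μ z h 0 = 0 := by
  simp [polyInner]

theorem polyInner_neg_left (f h : MvPolynomial σ ℂ) :
    polyInner μ z (-f) h = -polyInner μ z f h := by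
  simp [polyInner, integral_neg]

theorem polyInner_sub_left (hz : PolyIntegrable μ z) (f g h : MvPolynomial σ ℂ) :
    polyInner μ z (f - g) h = polyInner μ z f h - polyInner μ z g h := by
  rw [sub_eq_add_neg, polyInner_add_left hz, polyInner_neg_left, sub_eq_add_neg]

theorem polyInner_sub_right (hz : PolyIntegrable μ z) (f g h : MvPolynomial σ ℂ) :
    polyInner μ z f (g - h) = polyInner μ z f g - polyInner μ z f h := by
  rw [← conj_polyInner, polyInner_sub_left hz, map_sub, conj_polyInner, conj_polyInner]

theorem polyInner_sum_left {κ : Type} (hz : PolyIntegrable μ z) (s : Finset κ)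
    (f : κ → MvPolynomial σ ℂ) (h : MvPolynomial σ ℂ) :
    polyInner μ z (∑ i ∈ s, f i) h = ∑ i ∈ s, polyInner μ z (f i) h := by
  classical
  induction s using Finset.induction_on with
  | empty => simp [polyInner_zero_left]
  | insert a s ha ih => rw [Finset.sum_insert ha, Finset.sum_insert ha, polyInner_add_left hz, ih]

theorem polyInner_sum_right {κ : Type} (hz : PolyIntegrable μ z) (s : Finset κ)
    (f : κ → MvPolynomial σ ℂ) (h : MvPolynomial σ ℂ) :
    polyInner μ z h (∑ i ∈ s, f i) = ∑ i ∈ s, polyInner μ z h (f i) := by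
  rw [← conj_polyInner, polyInner_sum_left hz, map_sum]
  simp only [conj_polyInner]

theorem polyInner_self (f : MvPolynomial σ ℂ) :
    polyInner μ z f f = ((∫ ω, Complex.normSq (eval (z ω) f) ∂μ : ℝ) : ℂ) := by
  rw [polyInner, ← integral_complex_ofReal]
  simp [Complex.mul_conj]

theorem polyInner_self_nonneg (f : MvPolynomial σ ℂ) : 0 ≤ polyInner μ z f f := by
  rw [polyInner_self]
  exact_mod_cast integral_nonneg fun ω => Complex.normSq_nonneg _

theorem hasDerivAt_eval [Fintype σ] {c : ℝ → σ → ℂ} {c' : σ → ℂ} {t : ℝ}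
    (hc : ∀ s, HasDerivAt (fun t => c t s) (c' s) t) (f : MvPolynomial σ ℂ) :
    HasDerivAt (fun t => eval (c t) f) (∑ s, c' s * eval (c t) (pderiv s f)) t := by
  classical
  induction f using MvPolynomial.induction_on with
  | C a => simpa using hasDerivAt_const t a
  | add p q hp hq =>
    simp only [map_add, mul_add, Finset.sum_add_distrib]
    exact hp.add hq
  | mul_X p n hp =>
    have h := hp.mul (hc n)
    simp only [map_mul, eval_X]
    refine h.congr_deriv ?_
    simp only [pderiv_mul, pderiv_X, map_add, map_mul, eval_X, mul_add, Finset.sum_add_distrib,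
      Finset.sum_mul, Pi.single_apply, apply_ite (eval (c t)), map_one, map_zero]
    simp [mul_comm, mul_left_comm]

/-- The coordinates `z ∘ e` form a unitarily invariant random unit vector, independently of the
other coordinates. -/
structure IsSphericalBlock [Fintype ι] [DecidableEq ι] [DecidableEq σ] (μ : Measure Ω)
    (z : Ω → σ → ℂ) (e : ι → σ) : Prop where
  injective : Function.Injective e
  norm_sq : ∀ ω, ∑ i, z ω (e i) * conj (z ω (e i)) = 1
  -- Writing the action as z + (V - 1)z on the block gives one formula for all coordinates, which
  -- fixes those outside the block.
  invariant : ∀ V ∈ unitaryGroup ι ℂ, ∃ T : Ω → Ω, MeasurePreserving T μ μ ∧ ∀ ω s,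
    z (T ω) s = z ω s + ∑ i, if e i = s then ((V - 1) *ᵥ fun j => z ω (e j)) i else 0

/-- The derivation `∑ᵢⱼ uᵢ conj(wⱼ) Xⱼ ∂ᵢ`. -/
noncomputable def rankOneDeriv [Fintype ι] (e : ι → σ) (u w : ι → ℂ) (f : MvPolynomial σ ℂ) :
    MvPolynomial σ ℂ :=
  ∑ i, ∑ j, C (u i * conj (w j)) * (X (e j) * pderiv (e i) f)

theorem eval_rankOneDeriv [Fintype ι] (e : ι → σ) (u w : ι → ℂ) (f : MvPolynomial σ ℂ)
    (x : σ → ℂ) : eval x (rankOneDeriv e u w f) =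
      ∑ i, (u i * ∑ j, conj (w j) * x (e j)) * eval x (pderiv (e i) f) := by
  simp only [rankOneDeriv, map_sum, map_mul, eval_C, eval_X, Finset.mul_sum, Finset.sum_mul]
  exact Finset.sum_congr rfl fun i _ => Finset.sum_congr rfl fun j _ => by ring

/-- The unitary `1 + (exp(it) - 1) u u*`. -/
noncomputable def phaseUnitary [DecidableEq ι] (u : ι → ℂ) (t : ℝ) : Matrix ι ι ℂ :=
  1 + (Complex.exp (t * Complex.I) - 1) • vecMulVec u (star u)

theorem phaseUnitary_mem [Fintype ι] [DecidableEq ι] {u : ι → ℂ} (hu : star u ⬝ᵥ u = 1) (t : ℝ) :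
    phaseUnitary u t ∈ unitaryGroup ι ℂ := by
  rw [mem_unitaryGroup_iff]
  have h1 : star (vecMulVec u (star u)) = vecMulVec u (star u) := by
    rw [star_eq_conjTranspose, conjTranspose_vecMulVec, star_star]
  have h2 : vecMulVec u (star u) * vecMulVec u (star u) = vecMulVec u (star u) := by
    rw [vecMulVec_mul_vecMulVec, hu, one_smul]
  have h3 : Complex.exp (t * Complex.I) * conj (Complex.exp (t * Complex.I)) = 1 := by
    rw [Complex.mul_conj, Complex.normSq_eq_norm_sq, Complex.norm_exp_ofReal_mul_I]; simp
  simp only [phaseUnitary, star_add, star_one, star_smul, h1, add_mul, mul_add, one_mul, mul_one,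
    smul_mul_assoc, mul_smul_comm, h2, star_sub]
  rw [add_assoc, smul_add, smul_smul, ← add_smul, ← add_smul]
  simp only [Complex.star_def]
  rw [show Complex.exp (t * Complex.I) - 1 + (conj (Complex.exp (t * Complex.I)) - 1 +
    (conj (Complex.exp (t * Complex.I)) - 1) * (Complex.exp (t * Complex.I) - 1)) = 0 by
      linear_combination h3]
  simp

theorem phaseUnitary_sub_one_mulVec [Fintype ι] [DecidableEq ι] (u x : ι → ℂ) (t : ℝ) (i : ι) :
    ((phaseUnitary u t - 1) *ᵥ x) i =
      (Complex.exp (t * Complex.I) - 1) * (u i * ∑ j, conj (u j) * x j) := by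
  simp [phaseUnitary, smul_mulVec, vecMulVec_mulVec, dotProduct, mul_comm]

/-- The random vector `z` is measurable and bounded. -/
structure IsBoundedVector [MeasurableSpace Ω] (z : Ω → σ → ℂ) : Prop where
  measurable : ∀ s, Measurable fun ω => z ω s
  bounded : ∀ s, ∃ K : ℝ, ∀ ω, ‖z ω s‖ ≤ K

theorem IsBoundedVector.measurable_eval (hz : IsBoundedVector z) (f : MvPolynomial σ ℂ) :
    Measurable fun ω => eval (z ω) f := by
  induction f using MvPolynomial.induction_on with
  | C a => simp
  | add p q hp hq => simp only [map_add]; exact hp.add hq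
  | mul_X p n hp => simp only [map_mul, eval_X]; exact hp.mul (hz.measurable n)

theorem IsBoundedVector.bounded_eval (hz : IsBoundedVector z) (f : MvPolynomial σ ℂ) :
    ∃ K : ℝ, ∀ ω, ‖eval (z ω) f‖ ≤ K := by
  induction f using MvPolynomial.induction_on with
  | C a => exact ⟨‖a‖, fun ω => by simp⟩
  | add p q hp hq =>
    obtain ⟨K, hK⟩ := hp
    obtain ⟨L, hL⟩ := hq
    refine ⟨K + L, fun ω => ?_⟩
    rw [map_add]
    exact (norm_add_le _ _).trans (add_le_add (hK ω) (hL ω))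
  | mul_X p n hp =>
    obtain ⟨K, hK⟩ := hp
    obtain ⟨L, hL⟩ := hz.bounded n
    refine ⟨K * L, fun ω => ?_⟩
    rw [map_mul, eval_X, norm_mul]
    exact mul_le_mul (hK ω) (hL ω) (norm_nonneg _) ((norm_nonneg _).trans (hK ω))

theorem IsBoundedVector.polyIntegrable [IsProbabilityMeasure μ] (hz : IsBoundedVector z) :
    PolyIntegrable μ z := by
  intro f g
  obtain ⟨K, hK⟩ := hz.bounded_eval f
  obtain ⟨L, hL⟩ := hz.bounded_eval g
  refine Integrable.of_bound (C := K * L) ?_ (ae_of_all _ fun ω => ?_)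
  · exact ((hz.measurable_eval f).mul
      (Complex.continuous_conj.measurable.comp (hz.measurable_eval g))).aestronglyMeasurable
  · rw [norm_mul, Complex.norm_conj]
    exact mul_le_mul (hK ω) (hL ω) (norm_nonneg _) ((norm_nonneg _).trans (hK ω))

variable [Fintype σ] [DecidableEq σ] [Fintype ι] [DecidableEq ι]

/-- The component of the block along u is multiplied by exp(it) and everything else is fixed, so the
flow is generated by i times the derivation D = `rankOneDeriv e u u`. -/
theorem hasDerivAt_eval_phase (e : ι → σ) (he : Function.Injective e) {u : ι → ℂ}
    (hu : star u ⬝ᵥ u = 1) (x : σ → ℂ) {w : ℝ → σ → ℂ}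
    (hw : ∀ t s, w t s = x s +
      ∑ i, if e i = s then ((phaseUnitary u t - 1) *ᵥ fun j => x (e j)) i else 0)
    (f : MvPolynomial σ ℂ) (t : ℝ) :
    HasDerivAt (fun t => eval (w t) f)
      (Complex.I * eval (w t) (rankOneDeriv e u u f)) t := by
  have hu' : ∑ j, conj (u j) * u j = 1 := by simpa [dotProduct] using hu
  have hwe : ∑ j, conj (u j) * w t (e j) =
      Complex.exp (t * Complex.I) * ∑ j, conj (u j) * x (e j) := by
    have : ∀ j, w t (e j) = x (e j) +
        (Complex.exp (t * Complex.I) - 1) * (u j * ∑ j, conj (u j) * x (e j)) := by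
      intro j
      rw [hw, ← phaseUnitary_sub_one_mulVec u (fun j => x (e j)) t j]
      simp [he.eq_iff]
    simp only [this, mul_add, Finset.sum_add_distrib]
    have h2 : ∀ j, conj (u j) * ((Complex.exp (t * Complex.I) - 1) *
        (u j * ∑ j, conj (u j) * x (e j))) = (conj (u j) * u j) *
        ((Complex.exp (t * Complex.I) - 1) * ∑ j, conj (u j) * x (e j)) := fun j => by ring
    simp only [h2, ← Finset.sum_mul, hu']
    ring
  have hd : ∀ s, HasDerivAt (fun t => w t s) (∑ i, if e i = s then
      Complex.I * (u i * ∑ j, conj (u j) * w t (e j)) else 0) t := by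
    intro s
    simp only [hw _ s]
    refine HasDerivAt.const_add _ (HasDerivAt.fun_sum fun i _ => ?_)
    split_ifs with h
    · simp only [phaseUnitary_sub_one_mulVec, hwe]
      have h1 : HasDerivAt (fun t : ℝ => Complex.exp (t * Complex.I))
          (Complex.exp (t * Complex.I) * (1 * Complex.I)) t :=
        (((Complex.ofRealCLM.hasDerivAt (x := t))).mul_const Complex.I).cexp
      refine ((h1.sub_const 1).mul_const (u i * ∑ j, conj (u j) * x (e j))).congr_deriv ?_
      ring
    · exact hasDerivAt_const _ _
  refine (hasDerivAt_eval hd f).congr_deriv ?_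
  rw [eval_rankOneDeriv, Finset.mul_sum]
  simp only [Finset.sum_mul, ite_mul, zero_mul]
  rw [Finset.sum_comm]
  simp [mul_assoc]

/-- Invariance makes E[f conj g] constant along the phase flow. Its derivative at t = 0, taken under
the integral because everything is bounded, is i(⟨Df, g⟩ - ⟨f, Dg⟩). -/
theorem IsSphericalBlock.polyInner_rankOneDeriv_unit [IsProbabilityMeasure μ] {e : ι → σ}
    (h : IsSphericalBlock μ z e) (hz : IsBoundedVector z) {u : ι → ℂ} (hu : star u ⬝ᵥ u = 1)
    (f g : MvPolynomial σ ℂ) :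
    polyInner μ z (rankOneDeriv e u u f) g = polyInner μ z f (rankOneDeriv e u u g) := by
  choose T hT hTz using fun t => h.invariant _ (phaseUnitary_mem hu t)
  set D := rankOneDeriv e u u with hD
  have hder : ∀ ω f t, HasDerivAt (fun t => eval (z (T t ω)) f)
      (Complex.I * eval (z (T t ω)) (D f)) t := fun ω f t =>
    hasDerivAt_eval_phase e h.injective hu (z ω) (fun t s => hTz t ω s) f t
  have hmeas : ∀ t f, Measurable fun ω => eval (z (T t ω)) f := fun t f =>
    (hz.measurable_eval f).comp (hT t).measurable
  set F : ℝ → Ω → ℂ := fun t ω => eval (z (T t ω)) f * conj (eval (z (T t ω)) g) with hF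
  set F' : ℝ → Ω → ℂ := fun t ω => (Complex.I * eval (z (T t ω)) (D f)) *
    conj (eval (z (T t ω)) g) + eval (z (T t ω)) f *
    conj (Complex.I * eval (z (T t ω)) (D g)) with hF'
  obtain ⟨K1, h1⟩ := hz.bounded_eval f
  obtain ⟨K2, h2⟩ := hz.bounded_eval g
  obtain ⟨K3, h3⟩ := hz.bounded_eval (D f)
  obtain ⟨K4, h4⟩ := hz.bounded_eval (D g)
  have hFm : ∀ t, Measurable (F t) := fun t => (hmeas t f).mul
    (Complex.continuous_conj.measurable.comp (hmeas t g))
  have hF'm : ∀ t, Measurable (F' t) := fun t =>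
    (((hmeas t (D f)).const_mul Complex.I).mul
      (Complex.continuous_conj.measurable.comp (hmeas t g))).add
    ((hmeas t f).mul
      (Complex.continuous_conj.measurable.comp ((hmeas t (D g)).const_mul Complex.I)))
  have hconst : ∀ t, ∫ ω, F t ω ∂μ = polyInner μ z f g := by
    intro t
    rw [polyInner]
    conv_rhs => rw [← (hT t).map_eq]
    rw [integral_map (hT t).measurable.aemeasurable]
    exact ((hz.measurable_eval f).mul
      (Complex.continuous_conj.measurable.comp (hz.measurable_eval g))).aestronglyMeasurable
  have key := (hasDerivAt_integral_of_dominated_loc_of_deriv_le (μ := μ) (F := F) (F' := F')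
    (bound := fun _ => K3 * K2 + K1 * K4)
    (x₀ := (0 : ℝ)) (s := Set.univ) Filter.univ_mem
    (Filter.Eventually.of_forall fun t => (hFm t).aestronglyMeasurable)
    (Integrable.of_bound (C := K1 * K2) (hFm 0).aestronglyMeasurable (ae_of_all _ fun ω => by
      rw [hF, norm_mul, Complex.norm_conj]
      exact mul_le_mul (h1 _) (h2 _) (norm_nonneg _) ((norm_nonneg _).trans (h1 (T 0 ω)))))
    (hF'm 0).aestronglyMeasurable
    (ae_of_all _ fun ω t _ => by
      refine (norm_add_le _ _).trans ?_
      simp only [norm_mul, Complex.norm_conj, Complex.norm_I, one_mul]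
      exact add_le_add
        (mul_le_mul (h3 _) (h2 _) (norm_nonneg _) ((norm_nonneg _).trans (h3 (T t ω))))
        (mul_le_mul (h1 _) (h4 _) (norm_nonneg _) ((norm_nonneg _).trans (h1 (T t ω)))))
    (integrable_const _)
    (ae_of_all _ fun ω t _ => by
      exact (hder ω f t).mul ((Complex.conjCLE.toContinuousLinearMap.hasFDerivAt).comp_hasDerivAt t
        (hder ω g t)))).2
  simp only [hconst] at key
  have h0 := key.unique (hasDerivAt_const (0 : ℝ) (polyInner μ z f g))
  have hT0 : ∀ ω, z (T 0 ω) = z ω := by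
    intro ω
    funext s
    rw [hTz]
    simp [phaseUnitary]
  simp only [hF', hT0] at h0
  rw [integral_add] at h0
  · have e1 : ∀ ω, Complex.I * eval (z ω) (D f) * conj (eval (z ω) g) =
        Complex.I * (eval (z ω) (D f) * conj (eval (z ω) g)) := fun ω => by ring
    have e2 : ∀ ω, eval (z ω) f * conj (Complex.I * eval (z ω) (D g)) =
        -Complex.I * (eval (z ω) f * conj (eval (z ω) (D g))) := fun ω => by
      rw [map_mul, Complex.conj_I]; ring
    simp only [e1, e2, integral_const_mul] at h0
    change Complex.I * polyInner μ z (D f) g + -Complex.I * polyInner μ z f (D g) = 0 at h0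
    have := mul_eq_zero.mp (show Complex.I * (polyInner μ z (D f) g - polyInner μ z f (D g)) = 0 by
      linear_combination h0)
    exact sub_eq_zero.mp (this.resolve_left Complex.I_ne_zero)
  · have h := hz.polyIntegrable (μ := μ) (C Complex.I * D f) g
    simp only [map_mul, eval_C] at h
    exact h
  · have h := hz.polyIntegrable (μ := μ) f (C Complex.I * D g)
    simp only [eval_mul, eval_C] at h
    exact h

end PolyInner

/-! ### Integration by parts on the sphere -/

section Spherical

variable {Ω σ ι κ : Type} [MeasurableSpace Ω] {μ : Measure Ω} {z : Ω → σ → ℂ}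

theorem pderiv_comm (s t : σ) (f : MvPolynomial σ ℂ) :
    pderiv s (pderiv t f) = pderiv t (pderiv s f) := by
  classical
  induction f using MvPolynomial.induction_on with
  | C a => simp
  | add p q hp hq => simp [hp, hq]
  | mul_X p n hp =>
    simp only [pderiv_mul, map_add, hp, pderiv_X, Pi.single_apply]
    split_ifs <;> simp only [pderiv_one, map_zero, mul_one, mul_zero] <;> ring

/-- `f` is homogeneous of degree `k` in the variables of the block `e`. -/
def IsBlockHomogeneous [Fintype ι] (e : ι → σ) (k : ℝ) (f : MvPolynomial σ ℂ) : Prop :=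
  ∑ j, X (e j) * pderiv (e j) f = C (k : ℂ) * f

theorem isBlockHomogeneous_one [Fintype ι] (e : ι → σ) : IsBlockHomogeneous e 0 1 := by
  simp [IsBlockHomogeneous]

namespace IsBlockHomogeneous

variable [Fintype ι] {e : ι → σ} {k : ℝ} {f g : MvPolynomial σ ℂ}

theorem C_mul (hf : IsBlockHomogeneous e k f) (c : ℂ) : IsBlockHomogeneous e k (C c * f) := by
  unfold IsBlockHomogeneous at *
  simp only [pderiv_C_mul]
  rw [mul_left_comm, ← hf, Finset.mul_sum]
  exact Finset.sum_congr rfl fun j _ => by ring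

theorem add (hf : IsBlockHomogeneous e k f) (hg : IsBlockHomogeneous e k g) :
    IsBlockHomogeneous e k (f + g) := by
  unfold IsBlockHomogeneous at *
  simp only [map_add, mul_add, Finset.sum_add_distrib, hf, hg]

theorem zero : IsBlockHomogeneous e k 0 := by
  simp [IsBlockHomogeneous]

theorem sub (hf : IsBlockHomogeneous e k f) (hg : IsBlockHomogeneous e k g) :
    IsBlockHomogeneous e k (f - g) := by
  unfold IsBlockHomogeneous at *
  simp only [map_sub, mul_sub, Finset.sum_sub_distrib, hf, hg]

theorem sum {s : Finset κ} {F : κ → MvPolynomial σ ℂ}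
    (hf : ∀ i, IsBlockHomogeneous e k (F i)) : IsBlockHomogeneous e k (∑ i ∈ s, F i) := by
  classical
  induction s using Finset.induction_on with
  | empty => simpa using zero
  | insert a s ha ih => rw [Finset.sum_insert ha]; exact (hf a).add ih

theorem mul {l : ℝ} (hf : IsBlockHomogeneous e k f) (hg : IsBlockHomogeneous e l g) :
    IsBlockHomogeneous e (k + l) (f * g) := by
  unfold IsBlockHomogeneous at *
  have h : ∀ j, X (e j) * pderiv (e j) (f * g) =
      (X (e j) * pderiv (e j) f) * g + f * (X (e j) * pderiv (e j) g) := fun j => by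
    rw [pderiv_mul]; ring
  simp only [h, Finset.sum_add_distrib, ← Finset.sum_mul, ← Finset.mul_sum, hf, hg]
  push_cast
  rw [map_add]
  ring

theorem X_self [DecidableEq ι] (he : Function.Injective e) (i : ι) :
    IsBlockHomogeneous e 1 (X (e i)) := by
  classical
  unfold IsBlockHomogeneous
  simp [pderiv_X, Pi.single_apply, he.eq_iff]

theorem X_of_ne {s : σ} (hs : ∀ j, e j ≠ s) : IsBlockHomogeneous e 0 (X s) := by
  unfold IsBlockHomogeneous
  simp [pderiv_X_of_ne fun h => hs _ h.symm]

/-- Differentiate Euler's identity. Degrees are real numbers, so that k - 1 is not truncated at k =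
0. -/
theorem pderiv_self [DecidableEq ι] (he : Function.Injective e) (hf : IsBlockHomogeneous e k f)
    (i : ι) : IsBlockHomogeneous e (k - 1) (pderiv (e i) f) := by
  classical
  unfold IsBlockHomogeneous at *
  have h := congrArg (pderiv (e i)) hf
  simp only [map_sum, pderiv_mul, pderiv_X, Pi.single_apply, pderiv_C, he.eq_iff, ite_mul,
    one_mul, zero_mul, zero_add, Finset.sum_add_distrib, Finset.sum_ite_eq',
    Finset.mem_univ, if_true] at h
  simp only [pderiv_comm (e i)] at h
  push_cast
  rw [map_sub, sub_mul, ← h]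
  simp

theorem pderiv_of_ne {s : σ} (hs : ∀ j, e j ≠ s) (hf : IsBlockHomogeneous e k f) :
    IsBlockHomogeneous e k (pderiv s f) := by
  unfold IsBlockHomogeneous at *
  have h := congrArg (pderiv s) hf
  simp only [map_sum, pderiv_mul, pderiv_X_of_ne (hs _), zero_mul, zero_add, pderiv_C] at h
  simpa only [pderiv_comm s] using h

end IsBlockHomogeneous

/-- Polarization: a sesquilinear form over ℂ is determined by its diagonal. Test vectors e_a + c e_b
with c = 1, -1, i isolate the entry. -/
theorem eq_zero_of_forall_sum_conj [Fintype ι] [DecidableEq ι] {M : ι → ι → ℂ}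
    (h : ∀ u : ι → ℂ, ∑ i, ∑ j, u i * conj (u j) * M i j = 0) (a b : ι) : M a b = 0 := by
  have hexp : ∀ c : ℂ, M a a + conj c * M a b + (c * M b a + c * conj c * M b b) = 0 := by
    intro c
    have := h (Pi.single a 1 + c • Pi.single b 1)
    simp only [Pi.add_apply, Pi.smul_apply, smul_eq_mul, map_add, add_mul, mul_add,
      Finset.sum_add_distrib, Pi.single_apply, apply_ite conj, map_one, map_zero, ite_mul,
      mul_ite, mul_one, mul_zero, one_mul, zero_mul, Finset.sum_ite_eq',
      Finset.mem_univ, if_true] at this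
    linear_combination this
  have h0 := hexp 0
  have h1 := hexp 1
  have h2 := hexp (-1)
  have h3 := hexp Complex.I
  simp only [map_zero, map_one, map_neg, Complex.conj_I] at h0 h1 h2 h3
  have hI := Complex.I_mul_I
  linear_combination (1 / 4 : ℂ) * (h1 - h2) + Complex.I / 2 * (h3 - (h1 + h2) / 2)
    + (M b b * Complex.I / 2 + M a b / 2 - M b a / 2) * hI

variable [IsProbabilityMeasure μ] [Fintype σ] [DecidableEq σ] [Fintype ι] [DecidableEq ι]
  {e : ι → σ}

/-- Both sides scale by ‖u‖², which reduces the claim to unit vectors. -/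
theorem IsSphericalBlock.polyInner_rankOneDeriv
    (h : IsSphericalBlock μ z e) (hz : IsBoundedVector z) (u : ι → ℂ)
    (f g : MvPolynomial σ ℂ) :
    polyInner μ z (rankOneDeriv e u u f) g = polyInner μ z f (rankOneDeriv e u u g) := by
  by_cases hu : u = 0
  · simp [rankOneDeriv, hu, polyInner_zero_left, polyInner_zero_right]
  set N : ℝ := ∑ i, Complex.normSq (u i) with hN
  have hNpos : 0 < N := by
    obtain ⟨i, hi⟩ := Function.ne_iff.mp hu
    exact Finset.sum_pos' (fun i _ => Complex.normSq_nonneg _)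
      ⟨i, Finset.mem_univ _, Complex.normSq_pos.mpr hi⟩
  set r : ℝ := Real.sqrt N with hr
  have hr0 : (r : ℂ) ≠ 0 := by exact_mod_cast (Real.sqrt_pos.mpr hNpos).ne'
  have hrr : (r : ℂ) * r = N := by exact_mod_cast Real.mul_self_sqrt hNpos.le
  set v : ι → ℂ := fun i => (r : ℂ)⁻¹ * u i with hv
  have hvu : star v ⬝ᵥ v = 1 := by
    have : ∀ i, star v i * v i = (N : ℂ)⁻¹ * (Complex.normSq (u i) : ℂ) := by
      intro i
      rw [← Complex.mul_conj, ← hrr, mul_inv]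
      simp only [hv, Pi.star_apply, star_mul', Complex.star_def, map_inv₀, Complex.conj_ofReal]
      ring
    simp only [dotProduct, this, ← Finset.mul_sum]
    rw [← Complex.ofReal_sum, ← hN]
    exact inv_mul_cancel₀ (by exact_mod_cast hNpos.ne')
  have hD : ∀ f, rankOneDeriv e u u f = C (N : ℂ) * rankOneDeriv e v v f := by
    intro f
    simp only [rankOneDeriv, Finset.mul_sum, ← mul_assoc, ← map_mul]
    refine Finset.sum_congr rfl fun i _ => Finset.sum_congr rfl fun j _ => ?_
    congr 3
    simp only [hv, map_mul, map_inv₀, Complex.conj_ofReal, ← hrr]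
    field_simp
  rw [hD, hD, polyInner_C_mul_left, polyInner_C_mul_right,
    h.polyInner_rankOneDeriv_unit hz hvu, Complex.conj_ofReal]

/-- The adjoint of `Xⱼ ∂ᵢ` is `Xᵢ ∂ⱼ`. -/
theorem IsSphericalBlock.polyInner_X_mul_pderiv
    (h : IsSphericalBlock μ z e) (hz : IsBoundedVector z) (f g : MvPolynomial σ ℂ) (i j : ι) :
    polyInner μ z (X (e j) * pderiv (e i) f) g = polyInner μ z f (X (e i) * pderiv (e j) g) := by
  have hI := hz.polyIntegrable (μ := μ)
  refine sub_eq_zero.mp (eq_zero_of_forall_sum_conj (M := fun i j =>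
    polyInner μ z (X (e j) * pderiv (e i) f) g - polyInner μ z f (X (e i) * pderiv (e j) g))
    (fun u => ?_) i j)
  have key := h.polyInner_rankOneDeriv hz u f g
  simp only [rankOneDeriv, polyInner_sum_left hI, polyInner_sum_right hI, polyInner_C_mul_left,
    polyInner_C_mul_right] at key
  simp only [mul_sub, Finset.sum_sub_distrib]
  rw [key, sub_eq_zero]
  rw [Finset.sum_comm]
  refine Finset.sum_congr rfl fun i _ => Finset.sum_congr rfl fun j _ => ?_
  simp only [map_mul, Complex.conj_conj]
  ring

-- The normalization of the vector enters here: Σ|z_j|² = 1 can be inserted into any inner product.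
omit [Fintype σ] in
theorem IsSphericalBlock.sum_polyInner_X_mul (h : IsSphericalBlock μ z e)
    (hz : IsBoundedVector z) (f g : MvPolynomial σ ℂ) :
    ∑ j, polyInner μ z (X (e j) * f) (X (e j) * g) = polyInner μ z f g := by
  have hI := hz.polyIntegrable (μ := μ)
  simp only [polyInner]
  rw [← integral_finsetSum _ fun j _ => hI _ _]
  congr 1
  funext ω
  simp only [map_mul, eval_X]
  calc _ = (∑ j, z ω (e j) * conj (z ω (e j))) * (eval (z ω) f * conj (eval (z ω) g)) := by
        rw [Finset.sum_mul]
        exact Finset.sum_congr rfl fun j _ => by ring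
    _ = _ := by rw [h.norm_sq, one_mul]

/-- On the sphere the adjoint of multiplication by a coordinate is a multiple of the derivative. -/
theorem IsSphericalBlock.polyInner_X_mul (h : IsSphericalBlock μ z e) (hz : IsBoundedVector z)
    {k : ℝ} {f : MvPolynomial σ ℂ} (hf : IsBlockHomogeneous e k f) (g : MvPolynomial σ ℂ) (i : ι) :
    ((Fintype.card ι + k : ℝ) : ℂ) * polyInner μ z (X (e i) * f) g =
      polyInner μ z f (pderiv (e i) g) := by
  have hI := hz.polyIntegrable (μ := μ)
  -- Inserting Σ|z_j|² = 1 on the right and moving X_j ∂_i across gives ⟨X_i Σ_j ∂_j(X_j f), g⟩, and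
  -- Σ_j ∂_j(X_j f) = (n + k) f by Euler's identity.
  rw [← h.sum_polyInner_X_mul hz f]
  simp only [← h.polyInner_X_mul_pderiv hz]
  rw [← polyInner_sum_left hI]
  simp only [pderiv_mul, pderiv_X_self, one_mul, mul_add, Finset.sum_add_distrib]
  rw [← Finset.mul_sum, ← Finset.mul_sum, hf, ← polyInner_C_mul_left]
  congr 1
  simp only [Finset.sum_const, Finset.card_univ, nsmul_eq_mul]
  push_cast
  rw [map_add, map_natCast]
  ring

theorem IsSphericalBlock.polyInner_X_mul_right (h : IsSphericalBlock μ z e)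
    (hz : IsBoundedVector z) {k : ℝ} {g : MvPolynomial σ ℂ} (hg : IsBlockHomogeneous e k g)
    (f : MvPolynomial σ ℂ) (i : ι) :
    ((Fintype.card ι + k : ℝ) : ℂ) * polyInner μ z f (X (e i) * g) =
      polyInner μ z (pderiv (e i) f) g := by
  rw [← conj_polyInner, ← conj_polyInner g, ← h.polyInner_X_mul hz hg, map_mul,
    Complex.conj_ofReal]

-- Gram matrices are positive semidefinite: the sum is the squared norm of Σ conj(v_i) g_i.
omit [Fintype σ] [DecidableEq σ] [DecidableEq ι] in
theorem sum_conj_mul_polyInner_nonneg (hz : IsBoundedVector z) (v : ι → ℂ)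
    (g : ι → MvPolynomial σ ℂ) :
    0 ≤ ∑ i, ∑ j, v i * conj (v j) * polyInner μ z (g j) (g i) := by
  have hI := hz.polyIntegrable (μ := μ)
  have h := polyInner_self_nonneg (μ := μ) (z := z) (∑ i, C (conj (v i)) * g i)
  simp only [polyInner_sum_left hI, polyInner_sum_right hI, polyInner_C_mul_left,
    polyInner_C_mul_right, Complex.conj_conj] at h
  refine h.trans_eq ?_
  rw [Finset.sum_comm]
  exact Finset.sum_congr rfl fun i _ => Finset.sum_congr rfl fun j _ => by ring

omit [Fintype σ] [DecidableEq σ] [DecidableEq ι] in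
theorem polyInner_sum_mul_self (hz : IsBoundedVector z) (v : ι → ℂ) (L : ι → MvPolynomial σ ℂ)
    (f : MvPolynomial σ ℂ) :
    polyInner μ z ((∑ i, C (v i) * L i) * f) ((∑ i, C (v i) * L i) * f) =
      ∑ i, ∑ j, v i * conj (v j) * polyInner μ z (L i * f) (L j * f) := by
  have hI := hz.polyIntegrable (μ := μ)
  simp only [Finset.sum_mul, mul_assoc, polyInner_sum_left hI, polyInner_sum_right hI,
    polyInner_C_mul_left, polyInner_C_mul_right, mul_left_comm (conj (v _))]

/-- Moving X_j across, (n + k)⟨X_i f, X_j f⟩ = ⟨∂_j(X_i f), f⟩ = δ_ij⟨f, f⟩ + ⟨X_i ∂_j f, f⟩. The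
last term is ⟨∂_j f, ∂_i f⟩/(n + k - 1), a Gram matrix, so dropping it leaves a lower bound. The
positivity hypothesis is what this division requires. -/
theorem IsSphericalBlock.le_polyInner_linear_mul (h : IsSphericalBlock μ z e)
    (hz : IsBoundedVector z) {k : ℝ} {f : MvPolynomial σ ℂ} (hf : IsBlockHomogeneous e k f)
    (hk : 0 < Fintype.card ι + k - 1) (v : ι → ℂ) :
    ((∑ i, Complex.normSq (v i) : ℝ) : ℂ) * polyInner μ z f f ≤
      ((Fintype.card ι + k : ℝ) : ℂ) *
        polyInner μ z ((∑ i, C (v i) * X (e i)) * f) ((∑ i, C (v i) * X (e i)) * f) := by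
  have hI := hz.polyIntegrable (μ := μ)
  set c : ℝ := Fintype.card ι + k - 1 with hc
  have hc0 : (c : ℂ) ≠ 0 := by exact_mod_cast hk.ne'
  have key : ∀ i j, ((Fintype.card ι + k : ℝ) : ℂ) * polyInner μ z (X (e i) * f) (X (e j) * f) =
      (if i = j then polyInner μ z f f else 0) +
        (c : ℂ)⁻¹ * polyInner μ z (pderiv (e j) f) (pderiv (e i) f) := by
    intro i j
    rw [h.polyInner_X_mul_right hz hf, pderiv_mul, polyInner_add_left hI,
      ← h.polyInner_X_mul hz (hf.pderiv_self h.injective j), ← add_sub_assoc, ← hc,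
      inv_mul_cancel_left₀ hc0, pderiv_X, Pi.single_apply]
    simp only [h.injective.eq_iff]
    split_ifs <;> simp [polyInner_zero_left]
  rw [polyInner_sum_mul_self hz, Finset.mul_sum]
  simp only [Finset.mul_sum, mul_left_comm _ (v _ * conj (v _)), key, mul_add,
    Finset.sum_add_distrib, mul_ite, mul_zero, Finset.sum_ite_eq, Finset.mem_univ, if_true]
  simp only [Complex.mul_conj, ← Finset.sum_mul, Complex.ofReal_sum]
  refine le_add_of_nonneg_right ?_
  simp only [mul_left_comm _ (c : ℂ)⁻¹, ← Finset.mul_sum]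
  exact mul_nonneg (by exact_mod_cast (inv_pos.mpr hk).le) (sum_conj_mul_polyInner_nonneg hz v _)

end Spherical

/-! ### Products of two independent spheres -/

section TwoBlocks

variable {Ω σ A B : Type} [MeasurableSpace Ω] {μ : Measure Ω} {z : Ω → σ → ℂ}
  [IsProbabilityMeasure μ] [Fintype σ] [DecidableEq σ] [Fintype A] [DecidableEq A]
  [Fintype B] [DecidableEq B] {eA : A → σ} {eB : B → σ}

/-- The same argument in both blocks: Leibniz splits ∂_{b'}∂_{a'}(X_a X_b f) into four terms. One
gives the identity matrix times ⟨f, f⟩; the other three become Gram forms, in the derivatives along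
B, along A, and along both, and are discarded. The vector v need not be a product, so entangled
measurements across A and B are covered. -/
theorem le_polyInner_bilinear_mul (hA : IsSphericalBlock μ z eA) (hB : IsSphericalBlock μ z eB)
    (hAB : ∀ a b, eA a ≠ eB b) (hz : IsBoundedVector z) {k : ℝ} {f : MvPolynomial σ ℂ}
    (hfA : IsBlockHomogeneous eA k f) (hfB : IsBlockHomogeneous eB k f)
    (hkA : 0 < Fintype.card A + k - 1) (hkB : 0 < Fintype.card B + k - 1) (v : A × B → ℂ) :
    ((∑ p, Complex.normSq (v p) : ℝ) : ℂ) * polyInner μ z f f ≤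
      ((Fintype.card A + k : ℝ) : ℂ) * ((Fintype.card B + k : ℝ) : ℂ) *
        polyInner μ z ((∑ p, C (v p) * (X (eA p.1) * X (eB p.2))) * f)
          ((∑ p, C (v p) * (X (eA p.1) * X (eB p.2))) * f) := by
  have hI := hz.polyIntegrable (μ := μ)
  set c : ℝ := Fintype.card A + k - 1 with hc
  set c' : ℝ := Fintype.card B + k - 1 with hc'
  have hc0 : (c : ℂ) ≠ 0 := by exact_mod_cast hkA.ne'
  have hc0' : (c' : ℂ) ≠ 0 := by exact_mod_cast hkB.ne'
  have key : ∀ p q : A × B, ((Fintype.card A + k : ℝ) : ℂ) * ((Fintype.card B + k : ℝ) : ℂ) *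
      polyInner μ z (X (eA p.1) * X (eB p.2) * f) (X (eA q.1) * X (eB q.2) * f) =
      (if p = q then polyInner μ z f f else 0) +
      (if p.1 = q.1 then
        (c' : ℂ)⁻¹ * polyInner μ z (pderiv (eB q.2) f) (pderiv (eB p.2) f) else 0) +
      (if p.2 = q.2 then
        (c : ℂ)⁻¹ * polyInner μ z (pderiv (eA q.1) f) (pderiv (eA p.1) f) else 0) +
      (c : ℂ)⁻¹ * (c' : ℂ)⁻¹ * polyInner μ z (pderiv (eA q.1) (pderiv (eB q.2) f))
        (pderiv (eA p.1) (pderiv (eB p.2) f)) := by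
    rintro ⟨a, b⟩ ⟨a', b'⟩
    have hYf : IsBlockHomogeneous eA k (X (eB b') * f) := by
      simpa using (IsBlockHomogeneous.X_of_ne fun j => hAB j b').mul hfA
    have hdf : IsBlockHomogeneous eA k (pderiv (eB b') f) :=
      hfA.pderiv_of_ne fun j => hAB j b'
    have e1 : pderiv (eB b') (pderiv (eA a') (X (eA a) * X (eB b) * f)) =
        (if a = a' ∧ b = b' then f else 0) +
        (if a = a' then X (eB b) * pderiv (eB b') f else 0) +
        (if b = b' then X (eA a) * pderiv (eA a') f else 0) +
        X (eA a) * (X (eB b) * pderiv (eA a') (pderiv (eB b') f)) := by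
      have h1 : pderiv (eA a') (X (eB b) : MvPolynomial σ ℂ) = 0 :=
        pderiv_X_of_ne (hAB a' b).symm
      have h2 : pderiv (eB b') (X (eA a) : MvPolynomial σ ℂ) = 0 :=
        pderiv_X_of_ne (hAB a b')
      have h3 : pderiv (eA a') (X (eA a) : MvPolynomial σ ℂ) = if a = a' then 1 else 0 := by
        simp [pderiv_X, Pi.single_apply, hA.injective.eq_iff]
      have h4 : pderiv (eB b') (X (eB b) : MvPolynomial σ ℂ) = if b = b' then 1 else 0 := by
        simp [pderiv_X, Pi.single_apply, hB.injective.eq_iff]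
      simp only [pderiv_mul, map_add, h1, h2, h3, h4, pderiv_comm (eB b')]
      split_ifs <;> simp_all <;> ring
    have hdd : IsBlockHomogeneous eA (k - 1) (pderiv (eA a') (pderiv (eB b') f)) :=
      hdf.pderiv_self hA.injective a'
    have hdd' : IsBlockHomogeneous eB (k - 1) (pderiv (eA a') (pderiv (eB b') f)) :=
      (hfB.pderiv_self hB.injective b').pderiv_of_ne fun j => (hAB a' j).symm
    have hYdd : IsBlockHomogeneous eA (k - 1) (X (eB b) * pderiv (eA a') (pderiv (eB b') f)) := by
      simpa using (IsBlockHomogeneous.X_of_ne fun j => hAB j b).mul hdd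
    have hadd : (Fintype.card A : ℝ) + (k - 1) = c := by rw [hc]; ring
    have hadd' : (Fintype.card B : ℝ) + (k - 1) = c' := by rw [hc']; ring
    rw [mul_comm ((Fintype.card A + k : ℝ) : ℂ), mul_assoc, mul_assoc (X (eA a')),
      hA.polyInner_X_mul_right hz hYf, hB.polyInner_X_mul_right hz hfB, e1,
      polyInner_add_left hI, polyInner_add_left hI, polyInner_add_left hI]
    have t2 := hB.polyInner_X_mul hz (hfB.pderiv_self hB.injective b') f b
    have t3 := hA.polyInner_X_mul hz (hfA.pderiv_self hA.injective a') f a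
    have t4 := hA.polyInner_X_mul hz hYdd f a
    have t5 := hB.polyInner_X_mul hz hdd' (pderiv (eA a) f) b
    rw [hadd] at t3 t4
    rw [hadd'] at t2 t5
    rw [pderiv_comm (eB b)] at t5
    simp only [Prod.mk.injEq]
    rw [← t2, ← t3, ← t5, ← t4]
    congr 1
    · congr 1
      · congr 1
        · split_ifs <;> simp [polyInner_zero_left]
        · split_ifs <;> simp [polyInner_zero_left, hc0']
      · split_ifs <;> simp [polyInner_zero_left, hc0]
    · field_simp
  rw [polyInner_sum_mul_self hz, Finset.mul_sum]
  simp only [Finset.mul_sum, mul_left_comm _ (v _ * conj (v _)), key, mul_add,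
    Finset.sum_add_distrib]
  have s1 : ∑ p, ∑ q, v p * conj (v q) * (if p = q then polyInner μ z f f else 0) =
      ((∑ p, Complex.normSq (v p) : ℝ) : ℂ) * polyInner μ z f f := by
    simp [Complex.mul_conj, Finset.sum_mul]
  -- For each fixed index of A, the sum over the two indices of B is a Gram form; `s3` exchanges the
  -- roles.
  have s2 : 0 ≤ ∑ p : A × B, ∑ q : A × B, v p * conj (v q) * (if p.1 = q.1 then
        (c' : ℂ)⁻¹ * polyInner μ z (pderiv (eB q.2) f) (pderiv (eB p.2) f) else 0) := by
    have : ∀ a : A, 0 ≤ (c' : ℂ)⁻¹ * ∑ b, ∑ b', v (a, b) * conj (v (a, b')) *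
        polyInner μ z (pderiv (eB b') f) (pderiv (eB b) f) := fun a =>
      mul_nonneg (by exact_mod_cast (inv_pos.mpr hkB).le) (sum_conj_mul_polyInner_nonneg hz _ _)
    refine (Finset.sum_nonneg (s := Finset.univ) fun a _ => this a).trans_eq ?_
    simp only [Fintype.sum_prod_type, Finset.mul_sum]
    refine Finset.sum_congr rfl fun a _ => Finset.sum_congr rfl fun b _ => ?_
    rw [Finset.sum_comm]
    refine Finset.sum_congr rfl fun b' _ => ?_
    simp [mul_left_comm]
  have s3 : 0 ≤ ∑ p : A × B, ∑ q : A × B, v p * conj (v q) * (if p.2 = q.2 then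
        (c : ℂ)⁻¹ * polyInner μ z (pderiv (eA q.1) f) (pderiv (eA p.1) f) else 0) := by
    have : ∀ b : B, 0 ≤ (c : ℂ)⁻¹ * ∑ a, ∑ a', v (a, b) * conj (v (a', b)) *
        polyInner μ z (pderiv (eA a') f) (pderiv (eA a) f) := fun b =>
      mul_nonneg (by exact_mod_cast (inv_pos.mpr hkA).le)
        (sum_conj_mul_polyInner_nonneg hz (fun a => v (a, b)) _)
    refine (Finset.sum_nonneg (s := Finset.univ) fun b _ => this b).trans_eq ?_
    simp only [Fintype.sum_prod_type, Finset.mul_sum]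
    rw [Finset.sum_comm]
    refine Finset.sum_congr rfl fun a _ => Finset.sum_congr rfl fun b _ => ?_
    refine Finset.sum_congr rfl fun a' _ => ?_
    simp [mul_left_comm]
  have s4 : 0 ≤ ∑ p : A × B, ∑ q : A × B, v p * conj (v q) * ((c : ℂ)⁻¹ * (c' : ℂ)⁻¹ *
      polyInner μ z (pderiv (eA q.1) (pderiv (eB q.2) f))
        (pderiv (eA p.1) (pderiv (eB p.2) f))) := by
    simp only [mul_left_comm _ ((c : ℂ)⁻¹ * (c' : ℂ)⁻¹), ← Finset.mul_sum]
    refine mul_nonneg (mul_nonneg ?_ ?_) (sum_conj_mul_polyInner_nonneg hz v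
      fun p => pderiv (eA p.1) (pderiv (eB p.2) f))
    · exact_mod_cast (inv_pos.mpr hkA).le
    · exact_mod_cast (inv_pos.mpr hkB).le
  rw [s1, add_assoc, add_assoc]
  exact le_add_of_nonneg_right (add_nonneg s2 (add_nonneg s3 s4))

end TwoBlocks

theorem PosSemidef.exists_eq_conjTranspose_mul_self {ι : Type} [Fintype ι] [DecidableEq ι]
    {E : Matrix ι ι ℂ} (hE : E.PosSemidef) : ∃ R : Matrix ι ι ℂ, E = Rᴴ * R := by
  open scoped MatrixOrder in
  obtain ⟨R, hR⟩ := CStarAlgebra.nonneg_iff_eq_star_mul_self.mp hE.nonneg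
  exact ⟨R, hR⟩

/-! ### Haar random vectors as spherical blocks -/

section HaarVectors

variable (ι A B : Type) [Fintype ι] [DecidableEq ι] [Nonempty ι] [Fintype A] [DecidableEq A]
  [Nonempty A] [Fintype B] [DecidableEq B] [Nonempty B]

instance instIsProbabilityMeasureHaarUnitary : IsProbabilityMeasure (haarUnitary ι) :=
  ⟨Measure.haarMeasure_self (K₀ := ⊤)⟩

instance instIsMulLeftInvariantHaarUnitary : (haarUnitary ι).IsMulLeftInvariant := by
  unfold haarUnitary
  infer_instance

/-- The random unit vector `U |0⟩`. -/
noncomputable def haarVector (U : unitaryGroup ι ℂ) : ι → ℂ :=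
  (U : Matrix ι ι ℂ) *ᵥ Pi.single (Classical.arbitrary ι) 1

theorem continuous_haarVector : Continuous (haarVector ι) :=
  continuous_subtype_val.matrix_mulVec continuous_const

theorem haarVector_apply (U : unitaryGroup ι ℂ) (i : ι) :
    haarVector ι U i = (U : Matrix ι ι ℂ) i (Classical.arbitrary ι) := by
  simp [haarVector]

theorem haarVector_mul (V U : unitaryGroup ι ℂ) (i : ι) :
    haarVector ι (V * U) i = haarVector ι U i +
      (((V : Matrix ι ι ℂ) - 1) *ᵥ fun j => haarVector ι U j) i := by
  have h : haarVector ι (V * U) = (V : Matrix ι ι ℂ) *ᵥ haarVector ι U := by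
    rw [haarVector, haarVector, mulVec_mulVec]
    rfl
  rw [h, sub_mulVec, one_mulVec]
  simp

theorem isBoundedVector_haarVector : IsBoundedVector (haarVector ι) where
  measurable s := ((continuous_apply s).comp (continuous_haarVector ι)).measurable
  bounded s := ⟨1, fun U => by
    rw [haarVector_apply]
    exact entry_norm_bound_of_unitary U.2 _ _⟩

theorem sum_haarVector_mul_conj (U : unitaryGroup ι ℂ) :
    ∑ i, haarVector ι U i * conj (haarVector ι U i) = 1 := by
  have h := congrFun (congrFun (mem_unitaryGroup_iff'.mp U.2) (Classical.arbitrary ι))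
    (Classical.arbitrary ι)
  simp only [Matrix.mul_apply, star_apply, one_apply_eq, Complex.star_def] at h
  simpa [haarVector_apply, mul_comm] using h

theorem isSphericalBlock_haarVector :
    IsSphericalBlock (haarUnitary ι) (haarVector ι) (id : ι → ι) where
  injective := Function.injective_id
  norm_sq := sum_haarVector_mul_conj ι
  invariant V hV := by
    refine ⟨fun U => ⟨V, hV⟩ * U, measurePreserving_mul_left _ _, fun U s => ?_⟩
    simp [haarVector_mul]

/-- Two independent random unit vectors. -/
noncomputable def haarVectorPair (U : unitaryGroup A ℂ × unitaryGroup B ℂ) : A ⊕ B → ℂ :=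
  Sum.elim (haarVector A U.1) (haarVector B U.2)

theorem isBoundedVector_haarVectorPair : IsBoundedVector (haarVectorPair A B) where
  measurable s := by
    cases s with
    | inl a => exact ((isBoundedVector_haarVector A).measurable a).comp measurable_fst
    | inr b => exact ((isBoundedVector_haarVector B).measurable b).comp measurable_snd
  bounded s := by
    cases s with
    | inl a => exact ((isBoundedVector_haarVector A).bounded a).imp fun K hK U => hK U.1
    | inr b => exact ((isBoundedVector_haarVector B).bounded b).imp fun K hK U => hK U.2

theorem isSphericalBlock_haarVectorPair_inl :
    IsSphericalBlock ((haarUnitary A).prod (haarUnitary B)) (haarVectorPair A B) Sum.inl where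
  injective := Sum.inl_injective
  norm_sq U := sum_haarVector_mul_conj A U.1
  invariant V hV := by
    refine ⟨Prod.map (fun U => ⟨V, hV⟩ * U) id,
      (measurePreserving_mul_left _ _).prod (MeasurePreserving.id _), fun U s => ?_⟩
    cases s <;>  simp [haarVectorPair, haarVector_mul]

theorem isSphericalBlock_haarVectorPair_inr :
    IsSphericalBlock ((haarUnitary A).prod (haarUnitary B)) (haarVectorPair A B) Sum.inr where
  injective := Sum.inr_injective
  norm_sq U := sum_haarVector_mul_conj B U.2
  invariant V hV := by
    refine ⟨Prod.map id (fun U => ⟨V, hV⟩ * U),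
      (MeasurePreserving.id _).prod (measurePreserving_mul_left _ _), fun U s => ?_⟩
    cases s <;>  simp [haarVectorPair, haarVector_mul]

end HaarVectors

/-! ### Pure states and their tensor products -/

section

variable {ι A B : Type}

theorem continuous_ketbra : Continuous (ketbra : (ι → ℂ) → Matrix ι ι ℂ) :=
  continuous_id.matrix_vecMulVec continuous_star

theorem continuous_kronecker : Continuous fun x : Matrix A A ℂ × Matrix B B ℂ => x.1 ⊗ₖ x.2 := by
  refine continuous_matrix fun i j => ?_
  exact (continuous_fst.matrix_elem i.1 j.1).mul (continuous_snd.matrix_elem i.2 j.2)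

/-- The tensor product of two vectors. -/
def tensorVec (x : A ⊕ B → ℂ) (p : A × B) : ℂ := x (Sum.inl p.1) * x (Sum.inr p.2)

theorem ketbra_tensorVec (x : A ⊕ B → ℂ) :
    ketbra (tensorVec x) = ketbra (x ∘ Sum.inl) ⊗ₖ ketbra (x ∘ Sum.inr) := by
  ext p q
  simp [ketbra, tensorVec, vecMulVec_apply]
  ring

end

/-! ### The random states as images of Haar measure -/

section Integrals

variable {ι A B : Type} [Fintype ι] [DecidableEq ι] [Nonempty ι] [Fintype A] [DecidableEq A]
  [Nonempty A] [Fintype B] [DecidableEq B] [Nonempty B]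

instance instSecondCountableTopologyMatrix {ι κ : Type} [Fintype ι] [Fintype κ] :
    SecondCountableTopology (Matrix ι κ ℂ) :=
  inferInstanceAs (SecondCountableTopology (ι → κ → ℂ))

theorem measurable_ketbra_haarVector : Measurable fun U => ketbra (haarVector ι U) :=
  (continuous_ketbra.comp (continuous_haarVector ι)).measurable

theorem haarState_eq_map : haarState ι = (haarUnitary ι).map fun U => ketbra (haarVector ι U) := rfl

instance instIsProbabilityMeasureHaarState : IsProbabilityMeasure (haarState ι) :=
  Measure.isProbabilityMeasure_map measurable_ketbra_haarVector.aemeasurable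

omit [Fintype A] [DecidableEq A] [Nonempty A] [DecidableEq B] [Nonempty B] in
theorem measurable_kronecker : Measurable fun x : Matrix A A ℂ × Matrix B B ℂ => x.1 ⊗ₖ x.2 :=
  continuous_kronecker.measurable

theorem measurable_ketbra_haarVectorPair :
    Measurable fun U => ketbra (tensorVec (haarVectorPair A B U)) := by
  simp only [ketbra_tensorVec]
  exact measurable_kronecker.comp ((measurable_ketbra_haarVector.comp measurable_fst).prodMk
    (measurable_ketbra_haarVector.comp measurable_snd))

theorem haarProductState_eq_map : haarProductState A B =
    ((haarUnitary A).prod (haarUnitary B)).map fun U =>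
      ketbra (tensorVec (haarVectorPair A B U)) := by
  rw [haarProductState, haarState_eq_map, haarState_eq_map,
    Measure.map_prod_map _ _ measurable_ketbra_haarVector measurable_ketbra_haarVector,
    Measure.map_map measurable_kronecker
      (measurable_ketbra_haarVector.prodMap measurable_ketbra_haarVector)]
  congr 1
  funext U
  rw [ketbra_tensorVec]
  rfl

instance instIsProbabilityMeasureHaarProductState : IsProbabilityMeasure (haarProductState A B) := by
  rw [haarProductState_eq_map]
  exact Measure.isProbabilityMeasure_map measurable_ketbra_haarVectorPair.aemeasurable

end Integrals

/-! ### Born probabilities and single-copy protocols -/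

section Protocols

variable {ι : Type} [Fintype ι] [DecidableEq ι]

omit [DecidableEq ι] in
theorem trace_mul_ketbra (R : Matrix ι ι ℂ) (ψ : ι → ℂ) :
    (Rᴴ * R * ketbra ψ).trace.re = ∑ r, Complex.normSq (∑ i, R r i * ψ i) := by
  have h : (Rᴴ * R * ketbra ψ).trace = ∑ r, (R *ᵥ ψ) r * conj ((R *ᵥ ψ) r) := by
    rw [Matrix.mul_assoc, trace_mul_comm, ketbra, mul_vecMulVec, vecMulVec_mul, trace_vecMulVec,
      ← star_mulVec]
    rfl
  rw [h, Complex.re_sum]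
  exact Finset.sum_congr rfl fun r _ => by rw [Complex.mul_conj, Complex.ofReal_re]; rfl

omit [DecidableEq ι] in
theorem trace_conjTranspose_mul_self_re (R : Matrix ι ι ℂ) :
    (Rᴴ * R).trace.re = ∑ r, ∑ i, Complex.normSq (R r i) := by
  simp only [Matrix.trace, Matrix.diag_apply, Matrix.mul_apply, conjTranspose_apply, Complex.re_sum]
  rw [Finset.sum_comm]
  exact Finset.sum_congr rfl fun r _ => Finset.sum_congr rfl fun i _ => by
    rw [mul_comm, Complex.star_def, Complex.mul_conj, Complex.ofReal_re]

omit [DecidableEq ι] in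
theorem isDensity_ketbra {ψ : ι → ℂ} (hψ : ∑ i, ψ i * conj (ψ i) = 1) : IsDensity (ketbra ψ) := by
  refine ⟨posSemidef_vecMulVec_self_star ψ, ?_⟩
  rw [ketbra, trace_vecMulVec]
  exact hψ

/-- The maximally mixed state. -/
noncomputable def maximallyMixed (ι : Type) [Fintype ι] [DecidableEq ι] : Matrix ι ι ℂ :=
  ((Fintype.card ι : ℝ) : ℂ)⁻¹ • 1

theorem isDensity_maximallyMixed [Nonempty ι] : IsDensity (maximallyMixed ι) := by
  refine ⟨PosSemidef.one.smul ?_, ?_⟩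
  · exact_mod_cast inv_nonneg.mpr (Nat.cast_nonneg (α := ℝ) (Fintype.card ι))
  · have : (Fintype.card ι : ℂ) ≠ 0 := by exact_mod_cast Fintype.card_ne_zero
    simp [maximallyMixed, trace_smul, this]

theorem trace_mul_nonneg {E ρ : Matrix ι ι ℂ} (hE : E.PosSemidef) (hρ : ρ.PosSemidef) :
    0 ≤ (E * ρ).trace := by
  obtain ⟨R, rfl⟩ := PosSemidef.exists_eq_conjTranspose_mul_self hE
  rw [Matrix.mul_assoc, trace_mul_comm]
  exact (hρ.mul_mul_conjTranspose_same R).trace_nonneg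

namespace POVM

variable {O : Type} [Fintype O]

theorem prob_nonneg (M : POVM ι O) {ρ : Matrix ι ι ℂ} (hρ : IsDensity ρ) (o : O) :
    0 ≤ M.prob ρ o :=
  (Complex.le_def.mp (trace_mul_nonneg (M.posSemidef o) hρ.1)).1

theorem sum_prob_of_trace (M : POVM ι O) {ρ : Matrix ι ι ℂ} (hρ : ρ.trace = 1) :
    ∑ o, M.prob ρ o = 1 := by
  simp only [prob]
  rw [← Complex.re_sum, ← trace_sum, ← Finset.sum_mul, M.sum_effect, Matrix.one_mul, hρ,
    Complex.one_re]

theorem sum_prob (M : POVM ι O) {ρ : Matrix ι ι ℂ} (hρ : IsDensity ρ) :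
    ∑ o, M.prob ρ o = 1 :=
  M.sum_prob_of_trace hρ.2

theorem continuous_prob (M : POVM ι O) (o : O) : Continuous fun ρ => M.prob ρ o :=
  Complex.continuous_re.comp (continuous_const.matrix_mul continuous_id).matrix_trace

end POVM

namespace SingleCopyProtocol

/-- The protocol that declares "entangled" exactly when the given one does not. -/
noncomputable def compl : {T : ℕ} → SingleCopyProtocol ι T → SingleCopyProtocol ι T
  | _, .output value => .output (if value < 0 then 0 else -1)
  | _, @SingleCopyProtocol.measure _ _ _ _ _ _ M next => .measure M fun o => (next o).compl

theorem detectProb_compl {ρ : Matrix ι ι ℂ} (hρ : IsDensity ρ) {T : ℕ}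
    (P : SingleCopyProtocol ι T) : P.compl.detectProb ρ = 1 - P.detectProb ρ := by
  induction P with
  | output value =>
    simp only [compl, detectProb]
    split_ifs <;> simp_all
  | measure M next ih =>
    simp only [compl, detectProb, ih, mul_sub, mul_one, Finset.sum_sub_distrib, M.sum_prob hρ]

theorem detectProb_nonneg {ρ : Matrix ι ι ℂ} (hρ : IsDensity ρ) {T : ℕ}
    (P : SingleCopyProtocol ι T) : 0 ≤ P.detectProb ρ := by
  induction P with
  | output value =>
    simp only [detectProb]
    split_ifs <;> simp
  | measure M next ih =>
    exact Finset.sum_nonneg fun o _ => mul_nonneg (M.prob_nonneg hρ o) (ih o)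

theorem detectProb_le_one {ρ : Matrix ι ι ℂ} (hρ : IsDensity ρ) {T : ℕ}
    (P : SingleCopyProtocol ι T) : P.detectProb ρ ≤ 1 := by
  have h := P.compl.detectProb_nonneg hρ
  rw [detectProb_compl hρ] at h
  linarith

theorem continuous_detectProb {T : ℕ} (P : SingleCopyProtocol ι T) : Continuous P.detectProb := by
  induction P with
  | output value => exact continuous_const
  | measure M next ih =>
    exact continuous_finsetSum _ fun o _ => (M.continuous_prob o).mul (ih o)

end SingleCopyProtocol

/-! ### Comparison of a decision tree with the maximally mixed state -/

section Tree

variable {Ω σ : Type} [MeasurableSpace Ω] {μ : Measure Ω} [IsProbabilityMeasure μ]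
  {z : Ω → σ → ℂ} (q : ι → MvPolynomial σ ℂ)

/-- The pure state whose amplitudes are the values of the polynomials `q`. -/
noncomputable def polyState (x : σ → ℂ) : Matrix ι ι ℂ := ketbra fun i => eval x (q i)

/-- The linear form with coefficients `v` in the polynomials `q`. -/
noncomputable def polyForm (v : ι → ℂ) : MvPolynomial σ ℂ := ∑ i, C (v i) * q i

-- A Born probability is a sum, over the rows of R, of squared moduli of forms in the amplitudes, so
-- it can be absorbed into the polynomial weight |f|².
omit [DecidableEq ι] in
theorem prob_polyState_mul_normSq (R : Matrix ι ι ℂ) (x : σ → ℂ) (f : MvPolynomial σ ℂ) :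
    (Rᴴ * R * polyState q x).trace.re * Complex.normSq (eval x f) =
      ∑ r, Complex.normSq (eval x (polyForm q (R r) * f)) := by
  rw [polyState, trace_mul_ketbra, Finset.sum_mul]
  simp [polyForm]

theorem detectProb_measure_mul_normSq {T : ℕ} {O : Type} [Fintype O] (M : POVM ι O)
    (next : O → SingleCopyProtocol ι T) {R : O → Matrix ι ι ℂ}
    (hR : ∀ o, M.effect o = (R o)ᴴ * R o) (x : σ → ℂ) (f : MvPolynomial σ ℂ) :
    (SingleCopyProtocol.measure M next).detectProb (polyState q x) *
        Complex.normSq (eval x f) =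
      ∑ o, ∑ r, (next o).detectProb (polyState q x) *
        Complex.normSq (eval x (polyForm q (R o r) * f)) := by
  simp only [SingleCopyProtocol.detectProb, POVM.prob, hR, Finset.sum_mul, ← Finset.mul_sum,
    ← prob_polyState_mul_normSq]
  exact Finset.sum_congr rfl fun o _ => by ring

theorem integrable_detectProb_mul_normSq (hz : IsBoundedVector z) {T : ℕ}
    (P : SingleCopyProtocol ι T) (f : MvPolynomial σ ℂ) :
    Integrable (fun ω => P.detectProb (polyState q (z ω)) * Complex.normSq (eval (z ω) f)) μ := by
  induction P generalizing f with
  | output value =>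
    have h := (hz.polyIntegrable (μ := μ) f f).re
    simp only [Complex.mul_conj] at h
    exact h.const_mul _
  | measure M next ih =>
    choose R hR using fun o => PosSemidef.exists_eq_conjTranspose_mul_self (M.posSemidef o)
    simp only [detectProb_measure_mul_normSq q M next hR]
    exact integrable_finsetSum _ fun o _ => integrable_finsetSum _ fun r _ => ih o _

/-- The probability of a declaration, weighted by `|f|²`, is bounded below by a multiple of its
probability in the maximally mixed state. -/
theorem le_integral_detectProb_mul_normSq (hz : IsBoundedVector z) {m : ℝ} (hm : 0 < m)
    (hcard : (Fintype.card ι : ℝ) = m ^ 2) {H : ℕ → MvPolynomial σ ℂ → Prop}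
    (hH : ∀ k f, H k f → ∀ v, H (k + 1) (polyForm q v * f))
    (hbound : ∀ k f, H k f → ∀ v : ι → ℂ,
      (∑ i, Complex.normSq (v i)) * ∫ ω, Complex.normSq (eval (z ω) f) ∂μ ≤
        (m + k) ^ 2 * ∫ ω, Complex.normSq (eval (z ω) (polyForm q v * f)) ∂μ)
    {T : ℕ} (P : SingleCopyProtocol ι T) (k : ℕ) (f : MvPolynomial σ ℂ) (hf : H k f) :
    (∏ t ∈ Finset.range T, (m / (m + (k + t : ℕ))) ^ 2) * P.detectProb (maximallyMixed ι) *
        ∫ ω, Complex.normSq (eval (z ω) f) ∂μ ≤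
      ∫ ω, P.detectProb (polyState q (z ω)) * Complex.normSq (eval (z ω) f) ∂μ := by
  -- The polynomial f collects the forms of the outcomes seen so far and k counts them; both change
  -- on passing to a subtree.
  induction P generalizing k f with
  | @output T value =>
    simp only [SingleCopyProtocol.detectProb]
    rw [integral_const_mul, mul_assoc]
    -- A leaf may be reached before depth T; the factors left over are at most 1.
    refine mul_le_of_le_one_left (mul_nonneg (by split_ifs <;> simp)
      (integral_nonneg fun ω => Complex.normSq_nonneg _)) ?_
    refine Finset.prod_le_one (fun t _ => by positivity) fun t _ => ?_
    refine pow_le_one₀ (by positivity) ((div_le_one (by positivity)).mpr ?_)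
    linarith [Nat.cast_nonneg (α := ℝ) (k + t)]
  | @measure T O _ M next ih =>
    choose R hR using fun o => PosSemidef.exists_eq_conjTranspose_mul_self (M.posSemidef o)
    simp only [detectProb_measure_mul_normSq q M next hR]
    rw [integral_finsetSum _ fun o _ => integrable_finsetSum _ fun r _ =>
      integrable_detectProb_mul_normSq q hz _ _]
    simp only [integral_finsetSum _ fun r _ =>
      integrable_detectProb_mul_normSq (μ := μ) q hz (next _) _]
    set c := ∏ t ∈ Finset.range T, (m / (m + (k + 1 + t : ℕ))) ^ 2 with hc
    have hc0 : 0 ≤ c := Finset.prod_nonneg fun t _ => by positivity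
    set I := ∫ ω, Complex.normSq (eval (z ω) f) ∂μ with hI
    have hprod : ∏ t ∈ Finset.range (T + 1), (m / (m + (k + t : ℕ))) ^ 2 =
        c * (m / (m + k)) ^ 2 := by
      rw [Finset.prod_range_succ']
      simp only [hc, add_zero]
      congr 1
      refine Finset.prod_congr rfl fun t _ => ?_
      rw [show k + (t + 1) = k + 1 + t by ring]
    have hmk : 0 < m + k := by positivity
    -- Row r of R o contributes at least its squared norm over (m + k)². Summed over r this is the
    -- trace of the effect, which is m² times the outcome probability in the maximally mixed state;
    -- whence the factor (m/(m + k))².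
    have step : ∀ o r, c * (next o).detectProb (maximallyMixed ι) *
        ((∑ i, Complex.normSq (R o r i)) * I / (m + k) ^ 2) ≤
        ∫ ω, (next o).detectProb (polyState q (z ω)) *
          Complex.normSq (eval (z ω) (polyForm q (R o r) * f)) ∂μ := by
      intro o r
      have hne : Nonempty ι := ⟨r⟩
      refine le_trans ?_ (ih o (k + 1) _ (hH k f hf (R o r)))
      refine mul_le_mul_of_nonneg_left ?_
        (mul_nonneg hc0 ((next o).detectProb_nonneg isDensity_maximallyMixed))
      rw [div_le_iff₀ (by positivity)]
      linarith [hbound k f hf (R o r)]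
    refine le_trans (le_of_eq ?_)
      (Finset.sum_le_sum fun o _ => Finset.sum_le_sum fun r _ => step o r)
    have hprob : ∀ o, M.prob (maximallyMixed ι) o =
        (∑ r, ∑ i, Complex.normSq (R o r i)) / m ^ 2 := by
      intro o
      rw [POVM.prob, hR, maximallyMixed, Matrix.mul_smul, Matrix.mul_one, trace_smul, hcard,
        ← Complex.ofReal_inv, smul_eq_mul, Complex.re_ofReal_mul, trace_conjTranspose_mul_self_re]
      ring
    simp only [SingleCopyProtocol.detectProb, hprob, hprod]
    simp only [← Finset.mul_sum, ← Finset.sum_mul, ← Finset.sum_div]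
    rw [Finset.mul_sum, Finset.sum_mul]
    refine Finset.sum_congr rfl fun o _ => ?_
    field_simp

end Tree

end Protocols

/-! ### Completeness and soundness as Haar integrals -/

section TaskIntegrals

variable {ι A B : Type} [Fintype ι] [DecidableEq ι] [Nonempty ι] [Fintype A] [DecidableEq A]
  [Nonempty A] [Fintype B] [DecidableEq B] [Nonempty B]

theorem integral_haarState {p : Matrix ι ι ℂ → ℝ} (hp : Continuous p) :
    ∫ ρ, p ρ ∂haarState ι = ∫ U, p (ketbra (haarVector ι U)) ∂haarUnitary ι := by
  rw [haarState_eq_map, integral_map measurable_ketbra_haarVector.aemeasurable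
    hp.aestronglyMeasurable]

theorem integral_haarProductState {p : Matrix (A × B) (A × B) ℂ → ℝ} (hp : Continuous p) :
    ∫ ρ, p ρ ∂haarProductState A B = ∫ U, p (ketbra (tensorVec (haarVectorPair A B U)))
      ∂((haarUnitary A).prod (haarUnitary B)) := by
  rw [haarProductState_eq_map, integral_map measurable_ketbra_haarVectorPair.aemeasurable
    hp.aestronglyMeasurable]

theorem integrable_haarState {p : Matrix ι ι ℂ → ℝ} (hp : Continuous p) :
    Integrable p (haarState ι) := by
  rw [haarState_eq_map, integrable_map_measure hp.aestronglyMeasurable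
    measurable_ketbra_haarVector.aemeasurable]
  exact (hp.comp (continuous_ketbra.comp (continuous_haarVector ι))).integrable_of_hasCompactSupport
    (HasCompactSupport.of_compactSpace _)

instance instSecondCountableTopologyUnitaryGroup : SecondCountableTopology (unitaryGroup ι ℂ) :=
  TopologicalSpace.Subtype.secondCountableTopology _

theorem continuous_ketbra_haarVectorPair :
    Continuous fun U => ketbra (tensorVec (haarVectorPair A B U)) := by
  simp only [ketbra_tensorVec]
  exact continuous_kronecker.comp
    (((continuous_ketbra.comp (continuous_haarVector A)).comp continuous_fst).prodMk
      ((continuous_ketbra.comp (continuous_haarVector B)).comp continuous_snd))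

theorem integrable_haarProductState {p : Matrix (A × B) (A × B) ℂ → ℝ} (hp : Continuous p) :
    Integrable p (haarProductState A B) := by
  rw [haarProductState_eq_map, integrable_map_measure hp.aestronglyMeasurable
    measurable_ketbra_haarVectorPair.aemeasurable]
  exact (hp.comp continuous_ketbra_haarVectorPair).integrable_of_hasCompactSupport
    (HasCompactSupport.of_compactSpace _)

theorem sum_tensorVec_mul_conj (U : unitaryGroup A ℂ × unitaryGroup B ℂ) :
    ∑ p, tensorVec (haarVectorPair A B U) p * conj (tensorVec (haarVectorPair A B U) p) = 1 := by
  have h : ∀ p : A × B, tensorVec (haarVectorPair A B U) p *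
      conj (tensorVec (haarVectorPair A B U) p) =
      (haarVector A U.1 p.1 * conj (haarVector A U.1 p.1)) *
        (haarVector B U.2 p.2 * conj (haarVector B U.2 p.2)) := fun p => by
    simp only [tensorVec, haarVectorPair, Sum.elim_inl, Sum.elim_inr, map_mul]
    ring
  simp only [h, Fintype.sum_prod_type, ← Finset.mul_sum, sum_haarVector_mul_conj, mul_one]

omit [DecidableEq A] [Nonempty A] [DecidableEq B] [Nonempty B] in
theorem isSeparable_kronecker {ρ : Matrix A A ℂ} {τ : Matrix B B ℂ} (hρ : IsDensity ρ)
    (hτ : IsDensity τ) : IsSeparable (ρ ⊗ₖ τ) :=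
  ⟨1, fun _ => 1, fun _ => ρ, fun _ => τ, fun _ => zero_le_one, by simp, fun _ => hρ, fun _ => hτ,
    by simp⟩

/-- The product states form a compact, hence measurable, set of full measure that avoids the
entangled states; this avoids proving the entangled set measurable. -/
theorem haarProductState_entangled : haarProductState A B (entangled A B) = 0 := by
  set K := Set.range fun U => ketbra (tensorVec (haarVectorPair A B U)) with hK
  have hKm : MeasurableSet K := (isCompact_range continuous_ketbra_haarVectorPair).measurableSet
  refine measure_mono_null (t := Kᶜ) ?_ ?_
  · rintro _ hρ ⟨U, rfl⟩
    refine hρ.2 ?_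
    simp only [ketbra_tensorVec]
    exact isSeparable_kronecker (isDensity_ketbra (sum_haarVector_mul_conj A U.1))
      (isDensity_ketbra (sum_haarVector_mul_conj B U.2))
  · rw [haarProductState_eq_map, Measure.map_apply measurable_ketbra_haarVectorPair hKm.compl]
    convert measure_empty (μ := (haarUnitary A).prod (haarUnitary B))
    ext U
    simp [hK]

variable {m : ℕ} [NeZero m] {p : Matrix (Fin m × Fin m) (Fin m × Fin m) ℂ → ℝ}

theorem completeness_taskLaw (hp : Continuous p) : completeness (taskLaw m) p =
    (∫ ρ, p ρ ∂haarState (Fin m × Fin m) + ∫ ρ, p ρ ∂haarProductState (Fin m) (Fin m)) / 2 := by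
  rw [completeness, taskLaw, integral_add_measure
    ((integrable_haarState hp).smul_measure (by simp))
    ((integrable_haarProductState hp).smul_measure (by simp)), integral_smul_measure,
    integral_smul_measure]
  simp
  ring

theorem setIntegral_entangled_taskLaw :
    ∫ ρ in entangled (Fin m) (Fin m), p ρ ∂taskLaw m =
      (∫ ρ in entangled (Fin m) (Fin m), p ρ ∂haarState (Fin m × Fin m)) / 2 := by
  rw [taskLaw, Measure.restrict_add, Measure.restrict_smul, Measure.restrict_smul,
    Measure.restrict_eq_zero.mpr haarProductState_entangled, smul_zero, add_zero,
    integral_smul_measure]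
  simp
  ring

/-- An inequality is enough for the lower bound on T, so it need not be known that a Haar random
pure state is almost surely entangled. -/
theorem setIntegral_entangled_haarState_le (hp : Continuous p)
    (h0 : ∀ ρ, IsDensity ρ → 0 ≤ p ρ) :
    ∫ ρ in entangled (Fin m) (Fin m), p ρ ∂haarState (Fin m × Fin m) ≤
      ∫ ρ, p ρ ∂haarState (Fin m × Fin m) := by
  refine setIntegral_le_integral (integrable_haarState hp) ?_
  rw [haarState_eq_map]
  refine (ae_map_iff measurable_ketbra_haarVector.aemeasurable
    (isClosed_le continuous_const hp).measurableSet).mpr (ae_of_all _ fun U => ?_)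
  exact h0 _ (isDensity_ketbra (sum_haarVector_mul_conj _ U))

end TaskIntegrals

/-! ### The lower bound for adaptive single-copy protocols -/

section LowerBound

/-- Each factor is at least 1 - 2t/m, and the losses add up to at most T²/m because (t + 1)² - t² ≥
2t. -/
theorem one_sub_sq_div_le_prod {m : ℝ} (hm : 0 < m) (T : ℕ) :
    1 - (T : ℝ) ^ 2 / m ≤ ∏ t ∈ Finset.range T, (m / (m + (0 + t : ℕ))) ^ 2 := by
  induction T with
  | zero => simp
  | succ T ih =>
    rw [Finset.prod_range_succ]
    set c := ∏ t ∈ Finset.range T, (m / (m + (0 + t : ℕ))) ^ 2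
    have hc1 : c ≤ 1 := by
      refine Finset.prod_le_one (fun t _ => by positivity) fun t _ => ?_
      refine pow_le_one₀ (by positivity) ((div_le_one (by positivity)).mpr ?_)
      linarith [Nat.cast_nonneg (α := ℝ) (0 + t)]
    have hc0 : 0 ≤ c := Finset.prod_nonneg fun t _ => by positivity
    have hT : (0 : ℝ) ≤ T := Nat.cast_nonneg T
    have h1 : 1 - T / m ≤ m / (m + (0 + T : ℕ)) := by
      rw [zero_add, sub_le_iff_le_add, div_add_div _ _ (by positivity) hm.ne',
        le_div_iff₀ (by positivity)]
      nlinarith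
    have h2 : 1 - 2 * (T / m) ≤ (m / (m + (0 + T : ℕ))) ^ 2 := by
      have h3 : 0 ≤ m / (m + (0 + T : ℕ)) := by positivity
      nlinarith [sq_nonneg (m / (m + (0 + T : ℕ)) - 1)]
    have h4 : c * (1 - 2 * (T / m)) ≤ c * (m / (m + (0 + T : ℕ))) ^ 2 :=
      mul_le_mul_of_nonneg_left h2 hc0
    have h5 : c * (2 * (T / m)) ≤ 2 * (T / m) := mul_le_of_le_one_left (by positivity) hc1
    have h6 : ((T + 1 : ℕ) : ℝ) ^ 2 / m = (T : ℝ) ^ 2 / m + 2 * (T / m) + 1 / m := by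
      push_cast
      field_simp
      ring
    have h7 : 0 ≤ 1 / m := by positivity
    linarith

variable {m : ℕ} [NeZero m] {T : ℕ}

theorem isDensity_maximallyMixed_fin : IsDensity (maximallyMixed (Fin m × Fin m)) :=
  isDensity_maximallyMixed

theorem le_integral_detectProb_haarState (hm : 2 ≤ m)
    (P : SingleCopyProtocol (Fin m × Fin m) T) :
    (1 - (T : ℝ) ^ 2 / m) * P.detectProb (maximallyMixed (Fin m × Fin m)) ≤
      ∫ ρ, P.detectProb ρ ∂haarState (Fin m × Fin m) := by
  have hm0 : (2 : ℝ) ≤ m := by exact_mod_cast hm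
  have hz := isBoundedVector_haarVector (Fin m × Fin m)
  have key := le_integral_detectProb_mul_normSq (μ := haarUnitary (Fin m × Fin m))
    (X : Fin m × Fin m → MvPolynomial (Fin m × Fin m) ℂ) hz
    (m := m) (by linarith) (by simp [sq])
    (H := fun k f => IsBlockHomogeneous (id : Fin m × Fin m → Fin m × Fin m) k f)
    (fun k f hf v => by
      have h := (IsBlockHomogeneous.sum (s := Finset.univ) fun i =>
        (IsBlockHomogeneous.X_self Function.injective_id i).C_mul (v i)).mul hf
      rw [add_comm (1 : ℝ)] at h
      exact_mod_cast h)
    (fun k f hf v => by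
      have h := (isSphericalBlock_haarVector (Fin m × Fin m)).le_polyInner_linear_mul hz hf
        (by
          simp only [Fintype.card_prod, Fintype.card_fin, Nat.cast_mul]
          nlinarith [Nat.cast_nonneg (α := ℝ) k]) v
      rw [polyInner_self, polyInner_self, ← Complex.ofReal_mul, ← Complex.ofReal_mul,
        Complex.real_le_real] at h
      -- Here the sharp constant m² + k is relaxed to (m + k)², so that both laws fit the same
      -- comparison.
      refine h.trans (mul_le_mul_of_nonneg_right ?_
        (integral_nonneg fun _ => Complex.normSq_nonneg _))
      simp only [Fintype.card_prod, Fintype.card_fin, Nat.cast_mul]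
      nlinarith [Nat.cast_nonneg (α := ℝ) k])
    P 0 1 (by simpa using isBlockHomogeneous_one _)
  simp only [map_one, mul_one, integral_const, probReal_univ, smul_eq_mul] at key
  rw [integral_haarState P.continuous_detectProb]
  refine le_trans (mul_le_mul_of_nonneg_right (one_sub_sq_div_le_prod (by linarith) T)
    (P.detectProb_nonneg isDensity_maximallyMixed)) (key.trans_eq ?_)
  simp only [polyState, eval_X]

theorem le_integral_detectProb_haarProductState (hm : 2 ≤ m)
    (P : SingleCopyProtocol (Fin m × Fin m) T) :
    (1 - (T : ℝ) ^ 2 / m) * P.detectProb (maximallyMixed (Fin m × Fin m)) ≤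
      ∫ ρ, P.detectProb ρ ∂haarProductState (Fin m) (Fin m) := by
  have hm0 : (2 : ℝ) ≤ m := by exact_mod_cast hm
  have hz := isBoundedVector_haarVectorPair (Fin m) (Fin m)
  have key := le_integral_detectProb_mul_normSq
    (μ := (haarUnitary (Fin m)).prod (haarUnitary (Fin m)))
    (fun p : Fin m × Fin m => (X (Sum.inl p.1) * X (Sum.inr p.2) :
      MvPolynomial (Fin m ⊕ Fin m) ℂ)) hz
    (m := m) (by linarith) (by simp [sq])
    -- Each copy contributes one factor from each sphere, so the degrees in the two blocks stay
    -- equal.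
    (H := fun k f => IsBlockHomogeneous (Sum.inl : Fin m → Fin m ⊕ Fin m) k f ∧
      IsBlockHomogeneous (Sum.inr : Fin m → Fin m ⊕ Fin m) k f)
    (fun k f hf v => by
      have h1 := (IsBlockHomogeneous.sum (s := Finset.univ) fun i : Fin m × Fin m =>
        ((IsBlockHomogeneous.X_self Sum.inl_injective i.1).mul
          (IsBlockHomogeneous.X_of_ne (s := Sum.inr i.2) fun j => Sum.inl_ne_inr)).C_mul (v i)).mul
          hf.1
      have h2 := (IsBlockHomogeneous.sum (s := Finset.univ) fun i : Fin m × Fin m =>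
        ((IsBlockHomogeneous.X_of_ne (s := Sum.inl i.1) fun j => Sum.inr_ne_inl).mul
          (IsBlockHomogeneous.X_self Sum.inr_injective i.2)).C_mul (v i)).mul
          hf.2
      rw [add_zero, add_comm (1 : ℝ)] at h1
      rw [zero_add, add_comm (1 : ℝ)] at h2
      exact ⟨by exact_mod_cast h1, by exact_mod_cast h2⟩)
    (fun k f hf v => by
      -- At k = 0 this is where m ≥ 2 matters.
      have hpos : (0 : ℝ) < Fintype.card (Fin m) + k - 1 := by
        simp only [Fintype.card_fin]
        linarith [Nat.cast_nonneg (α := ℝ) k]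
      have h := le_polyInner_bilinear_mul (isSphericalBlock_haarVectorPair_inl (Fin m) (Fin m))
        (isSphericalBlock_haarVectorPair_inr (Fin m) (Fin m)) (fun _ _ => Sum.inl_ne_inr) hz
        hf.1 hf.2 hpos hpos v
      rw [polyInner_self, polyInner_self, ← Complex.ofReal_mul, ← Complex.ofReal_mul,
        ← Complex.ofReal_mul, Complex.real_le_real, ← sq] at h
      simp only [Fintype.card_fin] at h
      exact h)
    P 0 1 ⟨by simpa using isBlockHomogeneous_one _, by simpa using isBlockHomogeneous_one _⟩
  simp only [map_one, mul_one, integral_const, probReal_univ, smul_eq_mul] at key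
  rw [integral_haarProductState P.continuous_detectProb]
  refine le_trans (mul_le_mul_of_nonneg_right (one_sub_sq_div_le_prod (by linarith) T)
    (P.detectProb_nonneg isDensity_maximallyMixed)) (key.trans_eq ?_)
  simp only [polyState, map_mul, eval_X]
  rfl

theorem integral_detectProb_compl (P : SingleCopyProtocol (Fin m × Fin m) T) :
    ∫ ρ, P.compl.detectProb ρ ∂haarState (Fin m × Fin m) =
      1 - ∫ ρ, P.detectProb ρ ∂haarState (Fin m × Fin m) := by
  rw [integral_haarState P.compl.continuous_detectProb, integral_haarState P.continuous_detectProb]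
  simp only [SingleCopyProtocol.detectProb_compl (isDensity_ketbra (sum_haarVector_mul_conj _ _))]
  rw [integral_sub (integrable_const _)]
  · simp
  · have h := integrable_haarState P.continuous_detectProb
    rwa [haarState_eq_map, integrable_map_measure P.continuous_detectProb.aestronglyMeasurable
      measurable_ketbra_haarVector.aemeasurable] at h

/-- Write h, q, r for the detection probabilities under the Haar law, the product law and the
maximally mixed state, and δ = T²/m. The comparison gives q ≥ (1 - δ)r, and for the complementary
protocol 1 - h ≥ (1 - δ)(1 - r); so h - q ≤ δ. Soundness forces h ≥ (5/6)(h + q) and completeness h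
+ q ≥ 1/2, so h - q ≥ 1/3. -/
theorem le_sq_copies (hm : 2 ≤ m) (P : SingleCopyProtocol (Fin m × Fin m) T)
    (hc : 1 / 4 ≤ completeness (taskLaw m) P.detectProb)
    (hs : 5 / 6 ≤ soundness (taskLaw m) P.detectProb) : (m : ℝ) ≤ 6 * (T : ℝ) ^ 2 := by
  have hm0 : (0 : ℝ) < m := by positivity
  have hc' := hc
  rw [completeness_taskLaw P.continuous_detectProb] at hc'
  have hs' : 5 / 6 ≤ (∫ ρ in entangled (Fin m) (Fin m), P.detectProb ρ ∂taskLaw m) /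
    completeness (taskLaw m) P.detectProb := hs
  rw [le_div_iff₀ (by linarith), setIntegral_entangled_taskLaw,
    completeness_taskLaw P.continuous_detectProb] at hs'
  have hle := setIntegral_entangled_haarState_le P.continuous_detectProb
    fun ρ hρ => P.detectProb_nonneg hρ
  have h1 := le_integral_detectProb_haarState hm P.compl
  rw [integral_detectProb_compl, SingleCopyProtocol.detectProb_compl isDensity_maximallyMixed] at h1
  have h2 := le_integral_detectProb_haarProductState hm P
  have hr0 := P.detectProb_nonneg (isDensity_maximallyMixed_fin (m := m))
  have hr1 := P.detectProb_le_one (isDensity_maximallyMixed_fin (m := m))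
  set h := ∫ ρ, P.detectProb ρ ∂haarState (Fin m × Fin m)
  set q := ∫ ρ, P.detectProb ρ ∂haarProductState (Fin m) (Fin m)
  set r := P.detectProb (maximallyMixed (Fin m × Fin m))
  set δ := (T : ℝ) ^ 2 / m with hδ
  have hδ0 : 0 ≤ δ := by positivity
  -- The inequalities would even give 1/3; the weaker constant only affects c.
  have hδ6 : 1 / 6 ≤ δ := by nlinarith
  rw [hδ, div_le_div_iff₀ (by norm_num) hm0] at hδ6
  linarith

end LowerBound

/-! ### Purity, two by two minors and separability -/

section Purity

variable {A B : Type} [Fintype A] [Fintype B]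

/-- The reduced state of the first subsystem. -/
noncomputable def reducedA (ρ : Matrix (A × B) (A × B) ℂ) : Matrix A A ℂ :=
  Matrix.of fun a a' => ∑ b, ρ (a, b) (a', b)

/-- The sum of the squared moduli of the two by two minors of the coefficient matrix of `ψ`. -/
noncomputable def minorSum (ψ : A × B → ℂ) : ℝ :=
  ∑ a, ∑ a', ∑ b, ∑ b', Complex.normSq (ψ (a, b) * ψ (a', b') - ψ (a, b') * ψ (a', b))

theorem minorSum_nonneg (ψ : A × B → ℂ) : 0 ≤ minorSum ψ :=
  Finset.sum_nonneg fun _ _ => Finset.sum_nonneg fun _ _ => Finset.sum_nonneg fun _ _ =>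
    Finset.sum_nonneg fun _ _ => Complex.normSq_nonneg _

theorem trace_reducedA_ketbra_sq (ψ : A × B → ℂ) :
    (reducedA (ketbra ψ) * reducedA (ketbra ψ)).trace =
      ∑ a, ∑ a', ∑ b, ∑ b', ψ (a, b) * ψ (a', b') * conj (ψ (a, b') * ψ (a', b)) := by
  simp only [Matrix.trace, Matrix.diag_apply, Matrix.mul_apply, reducedA, of_apply, ketbra,
    vecMulVec_apply, Pi.star_apply, Complex.star_def, Finset.sum_mul_sum, map_mul]
  exact Finset.sum_congr rfl fun a _ => Finset.sum_congr rfl fun a' _ =>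
    Finset.sum_congr rfl fun b _ => Finset.sum_congr rfl fun b' _ => by ring

/-- In |x - y|² = |x|² + |y|² - 2 Re(x conj y) the two squares each sum to ‖ψ‖⁴ = 1, and each cross
term sums to Tr ρ_A². -/
theorem minorSum_eq {ψ : A × B → ℂ} (hψ : ∑ p, ψ p * conj (ψ p) = 1) :
    (minorSum ψ : ℂ) = 2 - 2 * (reducedA (ketbra ψ) * reducedA (ketbra ψ)).trace := by
  have hswap : ∀ G : A → A → B → B → ℂ,
      ∑ a, ∑ a', ∑ b, ∑ b', G a a' b' b = ∑ a, ∑ a', ∑ b, ∑ b', G a a' b b' := fun G =>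
    Finset.sum_congr rfl fun a _ => Finset.sum_congr rfl fun a' _ => Finset.sum_comm
  have h1 : ∑ a, ∑ a', ∑ b, ∑ b', ψ (a, b) * ψ (a', b') * conj (ψ (a, b) * ψ (a', b')) = 1 := by
    calc _ = (∑ p, ψ p * conj (ψ p)) * ∑ p, ψ p * conj (ψ p) := by
          simp only [Fintype.sum_prod_type, Finset.sum_mul_sum, map_mul]
          exact Finset.sum_congr rfl fun a _ => Finset.sum_congr rfl fun a' _ =>
            Finset.sum_congr rfl fun b _ => Finset.sum_congr rfl fun b' _ => by ring
      _ = 1 := by rw [hψ, one_mul]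
  have h2 := (hswap fun a a' b b' =>
    ψ (a, b) * ψ (a', b') * conj (ψ (a, b) * ψ (a', b'))).trans h1
  have h3 := trace_reducedA_ketbra_sq ψ
  have h4 := (hswap fun a a' b b' =>
    ψ (a, b) * ψ (a', b') * conj (ψ (a, b') * ψ (a', b))).trans h3.symm
  have e : ∀ x y : ℂ, ((Complex.normSq (x - y) : ℝ) : ℂ) =
      x * conj x + y * conj y - x * conj y - y * conj x := fun x y => by
    rw [← Complex.mul_conj, map_sub]; ring
  simp only [minorSum, Complex.ofReal_sum, e, Finset.sum_add_distrib, Finset.sum_sub_distrib]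
  rw [h1, h2, h4, ← h3]
  ring

/-- Cauchy–Schwarz on the diagonal of ρ_A gives Tr ρ_A² ≥ 1/|A|. -/
theorem minorSum_le [Nonempty A] {ψ : A × B → ℂ} (hψ : ∑ p, ψ p * conj (ψ p) = 1) :
    minorSum ψ ≤ 2 - 2 / Fintype.card A := by
  set ρ := reducedA (ketbra ψ) with hρ
  have hsym : ∀ a a', ρ a' a = conj (ρ a a') := by
    intro a a'
    simp [hρ, reducedA, ketbra, vecMulVec_apply, mul_comm]
  have htr : ∑ a, (ρ a a).re = 1 := by
    rw [← Complex.re_sum]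
    simp only [hρ, reducedA, of_apply, ketbra, vecMulVec_apply, Pi.star_apply, Complex.star_def]
    rw [← Fintype.sum_prod_type' (f := fun a b => ψ (a, b) * conj (ψ (a, b))), hψ, Complex.one_re]
  have hP : (ρ * ρ).trace = ((∑ a, ∑ a', Complex.normSq (ρ a a') : ℝ) : ℂ) := by
    simp only [Matrix.trace, Matrix.diag_apply, Matrix.mul_apply, Complex.ofReal_sum]
    exact Finset.sum_congr rfl fun a _ => Finset.sum_congr rfl fun a' _ => by
      rw [hsym a a', Complex.mul_conj]
  have h1 : ∑ a, (ρ a a).re ^ 2 ≤ ∑ a, ∑ a', Complex.normSq (ρ a a') := by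
    refine Finset.sum_le_sum fun a _ => le_trans ?_ (Finset.single_le_sum
      (f := fun a' => Complex.normSq (ρ a a')) (fun _ _ => Complex.normSq_nonneg _)
      (Finset.mem_univ a))
    rw [Complex.normSq_apply]
    nlinarith [mul_self_nonneg (ρ a a).im]
  have h2 := sq_sum_le_card_mul_sum_sq (s := (Finset.univ : Finset A)) (f := fun a => (ρ a a).re)
  rw [htr, Finset.card_univ] at h2
  have hc : (0 : ℝ) < Fintype.card A := by exact_mod_cast Fintype.card_pos
  have h3 : 1 / (Fintype.card A : ℝ) ≤ ∑ a, ∑ a', Complex.normSq (ρ a a') := by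
    rw [div_le_iff₀ hc]
    nlinarith
  have h4 := minorSum_eq hψ
  rw [← hρ, hP] at h4
  have h5 : minorSum ψ = 2 - 2 * ∑ a, ∑ a', Complex.normSq (ρ a a') := by exact_mod_cast h4
  rw [h5]
  have : 2 / (Fintype.card A : ℝ) = 2 * (1 / Fintype.card A) := by ring
  linarith

/-- With ρ = R*R and τ = Q*Q the left side is the squared Hilbert–Schmidt norm of RQ*, which is
submultiplicative. -/
theorem trace_mul_le {ι : Type} [Fintype ι] [DecidableEq ι] {ρ τ : Matrix ι ι ℂ}
    (hρ : ρ.PosSemidef) (hτ : τ.PosSemidef) :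
    (ρ * τ).trace.re ≤ ρ.trace.re * τ.trace.re := by
  obtain ⟨R, rfl⟩ := PosSemidef.exists_eq_conjTranspose_mul_self hρ
  obtain ⟨Q, rfl⟩ := PosSemidef.exists_eq_conjTranspose_mul_self hτ
  have h : (Rᴴ * R * (Qᴴ * Q)).trace = ((R * Qᴴ)ᴴ * (R * Qᴴ)).trace := by
    rw [conjTranspose_mul, conjTranspose_conjTranspose, ← Matrix.mul_assoc, trace_mul_comm]
    simp only [Matrix.mul_assoc]
  rw [h, trace_conjTranspose_mul_self_re, trace_conjTranspose_mul_self_re,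
    trace_conjTranspose_mul_self_re, Finset.sum_mul_sum]
  refine Finset.sum_le_sum fun i _ => Finset.sum_le_sum fun j _ => ?_
  simp only [Complex.normSq_eq_norm_sq, Matrix.mul_apply, conjTranspose_apply]
  calc ‖∑ k, R i k * star (Q j k)‖ ^ 2 ≤ (∑ k, ‖R i k‖ * ‖Q j k‖) ^ 2 := by
        refine pow_le_pow_left₀ (norm_nonneg _) ((norm_sum_le _ _).trans_eq ?_) 2
        simp
    _ ≤ _ := Finset.sum_mul_sq_le_sq_mul_sq _ _ _

/-- The purity criterion, term by term: Tr(A_i A_j) Tr(B_i B_j) ≤ Tr(A_i A_j), since the second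
factor is at most 1. -/
theorem IsSeparable.trace_sq_le [DecidableEq A] [DecidableEq B] {ρ : Matrix (A × B) (A × B) ℂ}
    (hρ : IsSeparable ρ) : (ρ * ρ).trace.re ≤ (reducedA ρ * reducedA ρ).trace.re := by
  obtain ⟨k, p, ρA, ρB, hp, -, hA, hB, rfl⟩ := hρ
  have hred : reducedA (∑ i, (p i : ℂ) • (ρA i ⊗ₖ ρB i)) = ∑ i, (p i : ℂ) • ρA i := by
    ext a a'
    simp only [reducedA, of_apply, Matrix.sum_apply, Matrix.smul_apply, kroneckerMap_apply,
      smul_eq_mul]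
    rw [Finset.sum_comm]
    refine Finset.sum_congr rfl fun i _ => ?_
    rw [← Finset.mul_sum, ← Finset.mul_sum]
    have := (hB i).2
    simp only [Matrix.trace, Matrix.diag_apply] at this
    rw [this, mul_one]
  rw [hred]
  simp only [Finset.sum_mul_sum, trace_sum, Matrix.smul_mul, Matrix.mul_smul, trace_smul,
    ← mul_kronecker_mul, trace_kronecker, Complex.re_sum, smul_eq_mul, Complex.re_ofReal_mul]
  refine Finset.sum_le_sum fun i _ => Finset.sum_le_sum fun j _ => ?_
  refine mul_le_mul_of_nonneg_left (mul_le_mul_of_nonneg_left ?_ (hp _)) (hp _)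
  have h1 := trace_mul_nonneg (hA i).1 (hA j).1
  have h2 := trace_mul_le (hB i).1 (hB j).1
  rw [(hB i).2, (hB j).2, Complex.one_re, mul_one] at h2
  have h3 := Complex.le_def.mp h1
  rw [Complex.mul_re, ← h3.2]
  simp only [Complex.zero_im, zero_mul, sub_zero]
  exact mul_le_of_le_one_right h3.1 h2

/-- A pure state has Tr ρ² = 1, so the purity criterion forces Tr ρ_A² ≥ 1, that is `minorSum ψ` ≤
0. -/
theorem minorSum_eq_zero_of_isSeparable [DecidableEq A] [DecidableEq B] {ψ : A × B → ℂ}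
    (hψ : ∑ p, ψ p * conj (ψ p) = 1) (h : IsSeparable (ketbra ψ)) : minorSum ψ = 0 := by
  refine le_antisymm ?_ (minorSum_nonneg ψ)
  have h1 := h.trace_sq_le
  have h2 : ketbra ψ * ketbra ψ = ketbra ψ := by
    have : star ψ ⬝ᵥ ψ = 1 := by simpa [dotProduct, mul_comm] using hψ
    rw [ketbra, vecMulVec_mul_vecMulVec, this, one_smul]
  rw [h2, (isDensity_ketbra hψ).2, Complex.one_re] at h1
  have h3 := congrArg Complex.re (minorSum_eq hψ)
  simp at h3
  linarith

end Purity

/-! ### Outcome statistics of the SWAP tests -/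

section SwapTest

variable {ι A B : Type} [Fintype ι] [DecidableEq ι] [Fintype A] [Fintype B] [DecidableEq A]
  [DecidableEq B]

omit [DecidableEq ι] in
theorem trace_tensorPower (ρ : Matrix ι ι ℂ) (T : ℕ) : (tensorPower ρ T).trace = ρ.trace ^ T := by
  classical
  simp only [Matrix.trace, Matrix.diag_apply, tensorPower, of_apply]
  rw [← Fintype.prod_sum fun (_ : Fin T) i => ρ i i]
  simp

theorem trace_swapA_mul (ρ : Matrix (A × B) (A × B) ℂ) :
    (swapA A B * (ρ ⊗ₖ ρ)).trace = (reducedA ρ * reducedA ρ).trace := by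
  have h : (swapA A B * (ρ ⊗ₖ ρ)).trace =
      ∑ y : (A × B) × (A × B), ρ y.1 (y.2.1, y.1.2) * ρ y.2 (y.1.1, y.2.2) := by
    simp only [Matrix.trace, Matrix.diag_apply, Matrix.mul_apply, swapA, of_apply, ite_mul,
      one_mul, zero_mul]
    rw [Finset.sum_comm]
    simp [kroneckerMap_apply]
  rw [h]
  simp only [Matrix.trace, Matrix.diag_apply, Matrix.mul_apply, reducedA, of_apply,
    Fintype.sum_prod_type, Finset.sum_mul_sum]
  exact Finset.sum_congr rfl fun a _ => Finset.sum_comm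

theorem trace_swapEffect_true_mul {ρ : Matrix (A × B) (A × B) ℂ} (hρ : ρ.trace = 1) :
    (swapEffect A B true * (ρ ⊗ₖ ρ)).trace =
      2⁻¹ * (1 + (reducedA ρ * reducedA ρ).trace) := by
  simp only [swapEffect, sign, if_true, Complex.ofReal_one, one_smul, Matrix.smul_mul,
    Matrix.add_mul, Matrix.one_mul, trace_smul, trace_add, trace_kronecker, hρ, trace_swapA_mul,
    smul_eq_mul, mul_one]

/-- Both the effect and ρ^{⊗2N} are products over the pairs, so the sums over configurations factor.
-/
theorem prob_swapTestPOVM (N : ℕ) (ρ : Matrix (A × B) (A × B) ℂ) (s : Fin N → Bool) :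
    (swapTestPOVM A B N).prob (tensorPower ρ (N * 2)) s =
      (∏ j, (swapEffect A B (s j) * (ρ ⊗ₖ ρ)).trace).re := by
  have e : ∀ F : Fin N → (A × B) × (A × B) → ℂ,
      ∑ z : Fin (N * 2) → A × B, ∏ j, F j (pair j z) = ∏ j, ∑ w, F j w := by
    intro F
    rw [Fintype.prod_sum]
    exact Fintype.sum_equiv (pairEquiv (A × B) N) _ _ fun _ => rfl
  have hT : ∀ x y : Fin (N * 2) → A × B, tensorPower ρ (N * 2) y x =
      ∏ j, (ρ ⊗ₖ ρ) (pair j y) (pair j x) := by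
    intro x y
    simp only [tensorPower, of_apply]
    rw [← Fintype.prod_equiv finProdFinEquiv (fun c => ρ (y (finProdFinEquiv c))
      (x (finProdFinEquiv c))) _ fun _ => rfl, Fintype.prod_prod_type]
    simp [Fin.prod_univ_two, pair, kroneckerMap_apply]
  rw [POVM.prob]
  congr 1
  simp only [Matrix.trace, Matrix.diag_apply, Matrix.mul_apply, hT, swapTestPOVM, of_apply,
    ← Finset.prod_mul_distrib]
  rw [← e fun j u => ∑ v, swapEffect A B (s j) u v * (ρ ⊗ₖ ρ) v u]
  exact Finset.sum_congr rfl fun x _ => e fun j v =>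
    swapEffect A B (s j) (pair j x) v * (ρ ⊗ₖ ρ) v (pair j x)

theorem swapTest_estimator_neg_iff {N : ℕ} (hN : 0 < N) (s : Fin N → Bool) :
    (∑ j, sign (s j)) / (N : ℝ) - 1 < 0 ↔ s ≠ fun _ => true := by
  have hN' : (0 : ℝ) < N := by exact_mod_cast hN
  rw [sub_neg, div_lt_one hN']
  have hle : ∀ b, sign b ≤ 1 := by intro b; cases b <;> norm_num [sign]
  constructor
  · rintro h rfl
    simp [sign] at h
  · intro h
    obtain ⟨j, hj⟩ := Function.ne_iff.mp h
    calc ∑ j, sign (s j) < ∑ _j : Fin N, (1 : ℝ) :=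
          Finset.sum_lt_sum (fun i _ => hle _) ⟨j, Finset.mem_univ j, by
            rw [Bool.eq_false_iff.mpr hj]; norm_num [sign]⟩
      _ = N := by simp

/-- The estimator is negative unless all N signs are +1. The pairs are independent, and each gives
+1 with probability (1 + Tr ρ_A²)/2 = 1 - `minorSum ψ`/4. -/
theorem detectProb_swapTestProtocol {N : ℕ} (hN : 0 < N) {ψ : A × B → ℂ}
    (hψ : ∑ p, ψ p * conj (ψ p) = 1) :
    (swapTestProtocol A B N).detectProb (ketbra ψ) = 1 - (1 - minorSum ψ / 4) ^ N := by
  have htr := (isDensity_ketbra hψ).2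
  have hsum := (swapTestPOVM A B N).sum_prob_of_trace
    (ρ := tensorPower (ketbra ψ) (N * 2)) (by rw [trace_tensorPower, htr, one_pow])
  have hprob : (swapTestPOVM A B N).prob (tensorPower (ketbra ψ) (N * 2)) (fun _ => true) =
      (1 - minorSum ψ / 4) ^ N := by
    have h := minorSum_eq hψ
    have h' : (reducedA (ketbra ψ) * reducedA (ketbra ψ)).trace =
        ((1 - minorSum ψ / 2 : ℝ) : ℂ) := by
      push_cast
      linear_combination (1 / 2 : ℂ) * h
    rw [prob_swapTestPOVM]
    simp only [trace_swapEffect_true_mul htr, h', Finset.prod_const, Finset.card_univ,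
      Fintype.card_fin]
    rw [show (2⁻¹ * (1 + ((1 - minorSum ψ / 2 : ℝ) : ℂ))) = ((1 - minorSum ψ / 4 : ℝ) : ℂ) by
      push_cast; ring, ← Complex.ofReal_pow, Complex.ofReal_re]
  have hdet : (swapTestProtocol A B N).detectProb (ketbra ψ) =
      ∑ s : Fin N → Bool, if s = fun _ => true then 0 else
        (swapTestPOVM A B N).prob (tensorPower (ketbra ψ) (N * 2)) s := by
    change (∑ s : Fin N → Bool, if (∑ j, sign (s j)) / (N : ℝ) - 1 < 0 then
      (swapTestPOVM A B N).prob (tensorPower (ketbra ψ) (N * 2)) s else 0) = _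
    refine Finset.sum_congr rfl fun s _ => ?_
    simp only [swapTest_estimator_neg_iff hN s, ne_eq, ite_not]
  rw [hdet, ← hprob, ← hsum, eq_sub_iff_add_eq]
  rw [← Finset.sum_erase_add _ _ (Finset.mem_univ (fun _ : Fin N => true)),
    ← Finset.sum_erase_add (f := (swapTestPOVM A B N).prob (tensorPower (ketbra ψ) (N * 2))) _
      (Finset.mem_univ (fun _ : Fin N => true)), if_pos rfl, add_zero]
  congr 1
  exact Finset.sum_congr rfl fun s hs => if_neg (Finset.ne_of_mem_erase hs)

end SwapTest

/-! ### Moments of a single minor -/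

section MinorMoments

variable {ι : Type} [Fintype ι] [DecidableEq ι] [Nonempty ι]

/-- The two by two minor `xᵢ xⱼ - xₖ xₗ` as a polynomial. -/
noncomputable def minorPoly (i j k l : ι) : MvPolynomial ι ℂ := X i * X j - X k * X l

/-- The differential operator `∂ᵢ ∂ⱼ - ∂ₖ ∂ₗ`. -/
noncomputable def minorDeriv (i j k l : ι) (g : MvPolynomial ι ℂ) : MvPolynomial ι ℂ :=
  pderiv j (pderiv i g) - pderiv l (pderiv k g)

/-- Apply the integration by parts twice, at degrees c + 1 and c: multiplication by a minor turns
into the corresponding differential operator. -/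
theorem polyInner_minorPoly_mul {c : ℝ} {h : MvPolynomial ι ℂ}
    (hh : IsBlockHomogeneous (id : ι → ι) c h) (g : MvPolynomial ι ℂ) (i j k l : ι) :
    ((Fintype.card ι + c : ℝ) : ℂ) * ((Fintype.card ι + c + 1 : ℝ) : ℂ) *
      polyInner (haarUnitary ι) (haarVector ι) (minorPoly i j k l * h) g =
      polyInner (haarUnitary ι) (haarVector ι) h (minorDeriv i j k l g) := by
  have hb := isSphericalBlock_haarVector ι
  have hz := isBoundedVector_haarVector ι
  have hI := hz.polyIntegrable (μ := haarUnitary ι)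
  have key : ∀ a b : ι, ((Fintype.card ι + c : ℝ) : ℂ) * ((Fintype.card ι + c + 1 : ℝ) : ℂ) *
      polyInner (haarUnitary ι) (haarVector ι) (X a * X b * h) g =
      polyInner (haarUnitary ι) (haarVector ι) h (pderiv b (pderiv a g)) := by
    intro a b
    have h1 := hb.polyInner_X_mul hz hh (pderiv a g) b
    have h2 := hb.polyInner_X_mul hz
      ((IsBlockHomogeneous.X_self Function.injective_id b).mul hh) g a
    rw [show (Fintype.card ι : ℝ) + (1 + c) = Fintype.card ι + c + 1 by ring] at h2
    simp only [id] at h1 h2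
    rw [← h1, ← h2, mul_assoc (X a)]
    ring
  rw [minorPoly, sub_mul, polyInner_sub_left hI, mul_sub, key, key, minorDeriv,
    polyInner_sub_right hI]

variable {i j k l : ι}

omit [Fintype ι] [Nonempty ι] in
theorem pderiv_minorPoly (hij : i ≠ j) (hik : i ≠ k) (hil : i ≠ l) (hjk : j ≠ k) (hjl : j ≠ l)
    (hkl : k ≠ l) : pderiv i (minorPoly i j k l) = X j ∧ pderiv j (minorPoly i j k l) = X i ∧
      pderiv k (minorPoly i j k l) = -X l ∧ pderiv l (minorPoly i j k l) = -X k := by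
  refine ⟨?_, ?_, ?_, ?_⟩ <;>
  simp [minorPoly, pderiv_X, hij, hik, hil, hjk, hjl, hkl, hij.symm,
    hik.symm, hil.symm, hjk.symm, hjl.symm, hkl.symm]

omit [Fintype ι] [Nonempty ι] in
theorem minorDeriv_minorPoly (hij : i ≠ j) (hik : i ≠ k) (hil : i ≠ l) (hjk : j ≠ k)
    (hjl : j ≠ l) (hkl : k ≠ l) : minorDeriv i j k l (minorPoly i j k l) = C 2 * 1 := by
  obtain ⟨h1, h2, h3, h4⟩ := pderiv_minorPoly hij hik hil hjk hjl hkl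
  rw [minorDeriv, h1, h3, map_neg, pderiv_X_self, pderiv_X_self]
  rw [show (C 2 : MvPolynomial ι ℂ) = 2 from map_ofNat C 2]
  ring

-- Cayley's identity for two by two determinants, det(∂) det^s = s(s + 1) det^(s-1), at s = 2; the
-- preceding lemma is s = 1.
omit [Fintype ι] [Nonempty ι] in
theorem minorDeriv_minorPoly_sq (hij : i ≠ j) (hik : i ≠ k) (hil : i ≠ l) (hjk : j ≠ k)
    (hjl : j ≠ l) (hkl : k ≠ l) :
    minorDeriv i j k l (minorPoly i j k l * minorPoly i j k l) = C 6 * minorPoly i j k l := by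
  obtain ⟨h1, h2, h3, h4⟩ := pderiv_minorPoly hij hik hil hjk hjl hkl
  simp only [minorDeriv, pderiv_mul, map_add, map_neg, h1, h2, h3, h4, pderiv_X_self]
  rw [show (C 6 : MvPolynomial ι ℂ) = 6 from map_ofNat C 6]
  simp only [minorPoly]
  ring

omit [Nonempty ι] in
theorem isBlockHomogeneous_minorPoly :
    IsBlockHomogeneous (id : ι → ι) 2 (minorPoly i j k l) := by
  have h : ∀ a b : ι, IsBlockHomogeneous (id : ι → ι) 2 (X a * X b) := fun a b => by
    have := (IsBlockHomogeneous.X_self Function.injective_id a).mul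
      (IsBlockHomogeneous.X_self Function.injective_id b)
    norm_num at this
    exact this
  exact (h i j).sub (h k l)

theorem integral_normSq_minor (hij : i ≠ j) (hik : i ≠ k) (hil : i ≠ l) (hjk : j ≠ k)
    (hjl : j ≠ l) (hkl : k ≠ l) :
    (Fintype.card ι * (Fintype.card ι + 1) : ℝ) *
      ∫ U, Complex.normSq (eval (haarVector ι U) (minorPoly i j k l)) ∂haarUnitary ι = 2 := by
  have h := polyInner_minorPoly_mul (isBlockHomogeneous_one (id : ι → ι)) (minorPoly i j k l)
    i j k l
  rw [minorDeriv_minorPoly hij hik hil hjk hjl hkl, polyInner_C_mul_right, mul_one,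
    polyInner_self, polyInner_self] at h
  simp only [map_one, integral_const, probReal_univ, add_zero, smul_eq_mul, mul_one,
    Complex.ofReal_one, map_ofNat] at h
  exact_mod_cast h

theorem integral_normSq_minor_sq (hij : i ≠ j) (hik : i ≠ k) (hil : i ≠ l) (hjk : j ≠ k)
    (hjl : j ≠ l) (hkl : k ≠ l) :
    ((Fintype.card ι + 2) * (Fintype.card ι + 3) : ℝ) *
      ∫ U, Complex.normSq (eval (haarVector ι U) (minorPoly i j k l)) ^ 2 ∂haarUnitary ι =
      6 * ∫ U, Complex.normSq (eval (haarVector ι U) (minorPoly i j k l)) ∂haarUnitary ι := by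
  have h := polyInner_minorPoly_mul (isBlockHomogeneous_minorPoly (i := i) (j := j) (k := k)
    (l := l)) (minorPoly i j k l * minorPoly i j k l) i j k l
  rw [minorDeriv_minorPoly_sq hij hik hil hjk hjl hkl, polyInner_C_mul_right,
    polyInner_self, polyInner_self] at h
  simp only [map_mul, map_ofNat] at h
  simp only [← sq] at h
  rw [show (Fintype.card ι : ℝ) + 2 + 1 = Fintype.card ι + 3 by ring] at h
  exact_mod_cast h

end MinorMoments

/-! ### Completeness of the SWAP test, uniformly in m -/

section SwapCompleteness

variable {m : ℕ} [NeZero m]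

omit [NeZero m] in
theorem eval_minorPoly_pair (ψ : Fin m × Fin m → ℂ) (a a' b b' : Fin m) :
    eval ψ (minorPoly (a, b) (a', b') (a, b') (a', b)) =
      ψ (a, b) * ψ (a', b') - ψ (a, b') * ψ (a', b) := by
  simp [minorPoly]

omit [NeZero m] in
theorem continuous_minorSum : Continuous (minorSum : (Fin m × Fin m → ℂ) → ℝ) := by
  unfold minorSum
  refine continuous_finsetSum _ fun a _ => continuous_finsetSum _ fun a' _ =>
    continuous_finsetSum _ fun b _ => continuous_finsetSum _ fun b' _ => ?_
  exact Complex.continuous_normSq.comp (by fun_prop)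

theorem integrable_comp_haarVector {F : (Fin m × Fin m → ℂ) → ℝ} (hF : Continuous F) :
    Integrable (fun U => F (haarVector (Fin m × Fin m) U)) (haarUnitary (Fin m × Fin m)) :=
  (hF.comp (continuous_haarVector _)).integrable_of_hasCompactSupport
    (HasCompactSupport.of_compactSpace _)

theorem integrable_one_sub_minorSum_pow (N : ℕ) : Integrable
    (fun U => (1 - minorSum (haarVector (Fin m × Fin m) U) / 4) ^ N)
    (haarUnitary (Fin m × Fin m)) :=
  integrable_comp_haarVector (F := fun ψ => (1 - minorSum ψ / 4) ^ N)
    ((continuous_const.sub (continuous_minorSum.div_const 4)).pow N)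

theorem integral_normSq_minor_pair (a a' b b' : Fin m) :
    ∫ U, Complex.normSq (haarVector (Fin m × Fin m) U (a, b) *
        haarVector (Fin m × Fin m) U (a', b') - haarVector (Fin m × Fin m) U (a, b') *
        haarVector (Fin m × Fin m) U (a', b)) ∂haarUnitary (Fin m × Fin m) =
      if a = a' then 0 else if b = b' then 0 else 2 / ((m : ℝ) ^ 2 * ((m : ℝ) ^ 2 + 1)) := by
  split_ifs with ha hb
  · subst ha
    simp [mul_comm]
  · subst hb
    simp
  · have h := integral_normSq_minor (i := (a, b)) (j := (a', b')) (k := (a, b')) (l := (a', b))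
      (by simp [ha]) (by simp [hb]) (by simp [ha]) (by simp [Ne.symm ha]) (by simp [Ne.symm hb])
      (by simp [ha])
    have hm : (0 : ℝ) < m := by exact_mod_cast Nat.pos_of_neZero m
    simp only [eval_minorPoly_pair, Fintype.card_prod, Fintype.card_fin, Nat.cast_mul] at h
    rw [eq_div_iff (by positivity), sq]
    linarith

/-- There are m²(m - 1)² index choices with a ≠ a' and b ≠ b', each of mean 2/(m²(m² + 1)); all
other minors vanish. -/
theorem integral_minorSum : ∫ U, minorSum (haarVector (Fin m × Fin m) U)
    ∂haarUnitary (Fin m × Fin m) = 2 * ((m : ℝ) - 1) ^ 2 / ((m : ℝ) ^ 2 + 1) := by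
  have hc : ∀ a a' b b' : Fin m, Continuous fun ψ : Fin m × Fin m → ℂ =>
      Complex.normSq (ψ (a, b) * ψ (a', b') - ψ (a, b') * ψ (a', b)) := fun a a' b b' =>
    Complex.continuous_normSq.comp (by fun_prop)
  have hi := fun a a' b b' => integrable_comp_haarVector (hc a a' b b')
  simp only [minorSum]
  rw [integral_finsetSum _ fun a _ => integrable_finsetSum _ fun a' _ =>
    integrable_finsetSum _ fun b _ => integrable_finsetSum _ fun b' _ => hi a a' b b']
  simp only [integral_finsetSum _ fun a' _ =>
    integrable_finsetSum _ fun b _ => integrable_finsetSum _ fun b' _ => hi _ a' b b',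
    integral_finsetSum _ fun b _ => integrable_finsetSum _ fun b' _ => hi _ _ b b',
    integral_finsetSum _ fun b' _ => hi _ _ _ b', integral_normSq_minor_pair]
  have hm : (0 : ℝ) < m := by exact_mod_cast Nat.pos_of_neZero m
  have hsum : ∀ x : ℝ, ∑ a : Fin m, ∑ a', (if a = a' then 0 else x) = m * ((m - 1) * x) := by
    intro x
    have : ∀ a : Fin m, ∑ a', (if a = a' then 0 else x) = (m - 1) * x := by
      intro a
      have h1 : ∀ a', (if a = a' then 0 else x) = x - if a = a' then x else 0 := fun a' => by
        split_ifs <;> simp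
      simp only [h1, Finset.sum_sub_distrib]
      simp
      ring
    simp [this]
  have h2 : ∀ a a' : Fin m, (∑ b : Fin m, ∑ b', if a = a' then (0 : ℝ) else if b = b' then 0 else
      2 / ((m : ℝ) ^ 2 * ((m : ℝ) ^ 2 + 1))) =
      if a = a' then 0 else m * ((m - 1) * (2 / ((m : ℝ) ^ 2 * ((m : ℝ) ^ 2 + 1)))) := by
    intro a a'
    split_ifs
    · simp
    · exact hsum _
  simp only [h2, hsum]
  field_simp

/-- The quadratic is tuned so that its mean in the case m = 2 is exactly 1/2. Near 0, Bernoulli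
gives (1 - q)^64 ≤ 1/(1 + 64q); beyond 1/32 the power is already below 1/5. -/
theorem one_sub_pow_le_quadratic {q : ℝ} (h0 : 0 ≤ q) (h1 : q ≤ 1) :
    (1 - q) ^ 64 ≤ (1 - 7 * q) ^ 2 + 1 / 5 := by
  by_cases hq : q ≤ 1 / 32
  · have hb := one_add_mul_le_pow (a := q) (by linarith) 64
    have h2 : (1 - q) ^ 64 * (1 + q) ^ 64 ≤ 1 := by
      rw [← mul_pow]
      exact pow_le_one₀ (by nlinarith) (by nlinarith)
    have h3 : 0 ≤ (1 - q) ^ 64 := pow_nonneg (by linarith) _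
    have h4 : (1 - q) ^ 64 * (1 + 64 * q) ≤ 1 := by
      push_cast at hb
      exact (mul_le_mul_of_nonneg_left hb h3).trans h2
    have h5 : 1 ≤ ((1 - 7 * q) ^ 2 + 1 / 5) * (1 + 64 * q) := by nlinarith
    exact le_of_mul_le_mul_right (h4.trans h5) (by positivity)
  · have h2 : (1 - q) ^ 64 ≤ (31 / 32) ^ 64 :=
      pow_le_pow_left₀ (by linarith) (by linarith) _
    have h3 : ((31 : ℝ) / 32) ^ 64 ≤ 1 / 5 := by norm_num
    nlinarith [sq_nonneg (1 - 7 * q)]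

/-- A convex function lies below its chord on [0, s]. -/
theorem pow_le_chord {w s : ℝ} (hs : 0 < s) (hs1 : s ≤ 1) (h0 : 0 ≤ w) (h1 : w ≤ s) (N : ℕ) :
    (1 - w) ^ N ≤ 1 - w / s * (1 - (1 - s) ^ N) := by
  have hc := (convexOn_pow (𝕜 := ℝ) N).2 (show (1 : ℝ) ∈ Set.Ici 0 by simp)
    (show 1 - s ∈ Set.Ici 0 by simpa using hs1)
    (show 0 ≤ 1 - w / s from sub_nonneg.mpr ((div_le_one hs).mpr h1))
    (show 0 ≤ w / s by positivity) (by ring)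
  simp only [smul_eq_mul, one_pow, mul_one] at hc
  have e : 1 - w / s + w / s * (1 - s) = 1 - w := by
    field_simp
    ring
  rw [e] at hc
  linarith

/-- The four index choices with a ≠ a' and b ≠ b' all give the squared modulus of the one
determinant, up to sign inside. -/
theorem minorSum_fin_two (ψ : Fin 2 × Fin 2 → ℂ) : minorSum ψ = 4 * Complex.normSq
    (eval ψ (minorPoly ((0 : Fin 2), (0 : Fin 2)) (1, 1) (0, 1) (1, 0))) := by
  rw [eval_minorPoly_pair, minorSum]
  simp only [Fin.sum_univ_two]
  have h : ∀ x y : ℂ, Complex.normSq (y - x) = Complex.normSq (x - y) := fun x y => by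
    rw [← Complex.normSq_neg, neg_sub]
  rw [h (ψ (0, 0) * ψ (1, 1)) (ψ (0, 1) * ψ (1, 0)), mul_comm (ψ (1, 0)) (ψ (0, 1)),
    mul_comm (ψ (1, 1)) (ψ (0, 0)), h (ψ (0, 0) * ψ (1, 1)) (ψ (0, 1) * ψ (1, 0))]
  simp [mul_comm]
  ring

theorem integrable_normSq_eval_haarVector_pow {ι : Type} [Fintype ι] [DecidableEq ι] [Nonempty ι]
    (M : MvPolynomial ι ℂ) (n : ℕ) :
    Integrable (fun U => Complex.normSq (eval (haarVector ι U) M) ^ n) (haarUnitary ι) :=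
  ((Complex.continuous_normSq.comp ((MvPolynomial.continuous_eval M).comp
    (continuous_haarVector ι))).pow n).integrable_of_hasCompactSupport
      (HasCompactSupport.of_compactSpace _)

/-- In dimension 4 the squared modulus q has E q = 1/10 and E q² = 1/70, so the mean is 1 - 14/10 +
49/70 + 1/5 = 1/2. -/
theorem integral_quadratic_normSq_minor {ι : Type} [Fintype ι] [DecidableEq ι] [Nonempty ι]
    (hcard : Fintype.card ι = 4) {i j k l : ι} (hij : i ≠ j) (hik : i ≠ k) (hil : i ≠ l)
    (hjk : j ≠ k) (hjl : j ≠ l) (hkl : k ≠ l) :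
    ∫ U, ((1 - 7 * Complex.normSq (eval (haarVector ι U) (minorPoly i j k l))) ^ 2 + 1 / 5)
      ∂haarUnitary ι = 1 / 2 := by
  have e1 := integral_normSq_minor hij hik hil hjk hjl hkl
  have e2 := integral_normSq_minor_sq hij hik hil hjk hjl hkl
  generalize minorPoly i j k l = M at e1 e2 ⊢
  rw [hcard] at e1 e2
  have i1 := integrable_normSq_eval_haarVector_pow M 1
  have i2 := integrable_normSq_eval_haarVector_pow M 2
  simp only [pow_one] at i1
  have h : ∀ q : ℝ, (1 - 7 * q) ^ 2 + 1 / 5 = 6 / 5 - 14 * q + 49 * q ^ 2 := fun q => by ring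
  simp only [h]
  have i3 : Integrable (fun U => 6 / 5 - 14 * Complex.normSq (eval (haarVector ι U) M))
      (haarUnitary ι) := (integrable_const _).sub (i1.const_mul 14)
  rw [integral_add i3 (i2.const_mul 49), integral_sub (integrable_const _) (i1.const_mul 14),
    integral_const_mul, integral_const_mul]
  simp only [integral_const, probReal_univ, smul_eq_mul]
  norm_num at e1 e2 ⊢
  linarith

theorem one_sub_minorSum_pow_le_fin_two {N : ℕ}
    (hN : ∀ q : ℝ, 0 ≤ q → q ≤ 1 → (1 - q) ^ N ≤ (1 - 7 * q) ^ 2 + 1 / 5)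
    {ψ : Fin 2 × Fin 2 → ℂ} (hψ : ∑ p, ψ p * conj (ψ p) = 1) :
    (1 - minorSum ψ / 4) ^ N ≤ (1 - 7 * Complex.normSq (eval ψ
      (minorPoly ((0 : Fin 2), (0 : Fin 2)) (1, 1) (0, 1) (1, 0)))) ^ 2 + 1 / 5 := by
  have h1 := minorSum_le hψ
  have h2 := minorSum_fin_two ψ
  have h3 := Complex.normSq_nonneg
    (eval ψ (minorPoly ((0 : Fin 2), (0 : Fin 2)) (1, 1) (0, 1) (1, 0)))
  generalize Complex.normSq
    (eval ψ (minorPoly ((0 : Fin 2), (0 : Fin 2)) (1, 1) (0, 1) (1, 0))) = q at h2 h3 ⊢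
  rw [Fintype.card_fin] at h1
  norm_num at h1
  rw [show minorSum ψ / 4 = q by linarith]
  exact hN q h3 (by linarith)

theorem integral_one_sub_minorSum_pow_le_fin_two {N : ℕ}
    (hN : ∀ q : ℝ, 0 ≤ q → q ≤ 1 → (1 - q) ^ N ≤ (1 - 7 * q) ^ 2 + 1 / 5) :
    ∫ U, (1 - minorSum (haarVector (Fin 2 × Fin 2) U) / 4) ^ N
      ∂haarUnitary (Fin 2 × Fin 2) ≤ 1 / 2 := by
  rw [← integral_quadratic_normSq_minor (ι := Fin 2 × Fin 2) (by simp)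
    (i := (0, 0)) (j := (1, 1)) (k := (0, 1)) (l := (1, 0))
    (by decide) (by decide) (by decide) (by decide) (by decide) (by decide)]
  refine integral_mono (integrable_one_sub_minorSum_pow N) ?_ fun U =>
    one_sub_minorSum_pow_le_fin_two hN (sum_haarVector_mul_conj _ U)
  exact integrable_comp_haarVector (F := fun ψ => (1 - 7 * Complex.normSq (eval ψ
      (minorPoly ((0 : Fin 2), (0 : Fin 2)) (1, 1) (0, 1) (1, 0)))) ^ 2 + 1 / 5)
    (((continuous_const.sub (continuous_const.mul (Complex.continuous_normSq.comp
      (MvPolynomial.continuous_eval _)))).pow 2).add continuous_const)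

/-- On its range [0, s] with s = (1 - 1/m)/2 ≥ 1/3, the variable w = `minorSum`/4 satisfies the
chord bound, so only its mean is needed. -/
theorem integral_one_sub_minorSum_pow_le_of_two_lt {N : ℕ} (hN : (2 / 3 : ℝ) ^ N ≤ 1 / 6)
    (hm3 : 2 < m) : ∫ U, (1 - minorSum (haarVector (Fin m × Fin m) U) / 4) ^ N
      ∂haarUnitary (Fin m × Fin m) ≤ 1 / 2 := by
  have hm0 : (3 : ℝ) ≤ m := by exact_mod_cast hm3
  set s : ℝ := (1 - 1 / m) / 2 with hs
  have hinv : 1 / (m : ℝ) ≤ 1 / 3 := one_div_le_one_div_of_le (by norm_num) hm0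
  have hinv0 : 0 < 1 / (m : ℝ) := by positivity
  have hs0 : 1 / 3 ≤ s := by rw [hs]; linarith
  have hs1 : s ≤ 1 := by rw [hs]; linarith
  have hi := integrable_comp_haarVector (m := m) continuous_minorSum
  have heps : (1 - s) ^ N ≤ 1 / 6 := by
    refine (pow_le_pow_left₀ (by linarith) (show 1 - s ≤ 2 / 3 by linarith) N).trans hN
  calc _ ≤ ∫ U, (1 - (1 - (1 - s) ^ N) / (4 * s) *
        minorSum (haarVector (Fin m × Fin m) U)) ∂haarUnitary (Fin m × Fin m) := by
        refine integral_mono ?_ ?_ fun U => ?_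
        · exact integrable_one_sub_minorSum_pow N
        · exact (integrable_const _).sub (hi.const_mul _)
        · have h1 := minorSum_le (sum_haarVector_mul_conj (Fin m × Fin m) U)
          simp only [Fintype.card_fin] at h1
          have h2 := minorSum_nonneg (haarVector (Fin m × Fin m) U)
          have h3 : minorSum (haarVector (Fin m × Fin m) U) / 4 ≤ s := by
            rw [hs]
            have : 2 / (m : ℝ) = 2 * (1 / m) := by ring
            linarith
          refine (pow_le_chord (by linarith) hs1 (by positivity) h3 N).trans_eq ?_
          field_simp
    _ ≤ 1 / 2 := by
        rw [integral_sub (integrable_const _) (hi.const_mul _), integral_const_mul,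
          integral_minorSum]
        simp only [integral_const, probReal_univ, smul_eq_mul, mul_one]
        -- The ratio E w / s equals m(m - 1)/(m² + 1): it is 3/5 at m = 3, and (3/5)(1 - 1/6) = 1/2.
        -- At m = 2 it is only 2/5, hence the separate argument there.
        have h1 : 3 / 5 ≤ (2 * ((m : ℝ) - 1) ^ 2 / ((m : ℝ) ^ 2 + 1)) / (4 * s) := by
          have hs4 : 4 * s = 2 * ((m : ℝ) - 1) / m := by
            rw [hs]
            field_simp
            ring
          rw [hs4, div_div_div_eq, div_le_div_iff₀ (by norm_num)
            (mul_pos (by positivity) (by linarith))]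
          nlinarith [mul_nonneg (sub_nonneg.mpr (show (1 : ℝ) ≤ m by linarith))
            (sub_nonneg.mpr hm0), mul_nonneg (mul_nonneg
              (sub_nonneg.mpr (show (1 : ℝ) ≤ m by linarith)) (sub_nonneg.mpr hm0))
              (show (0 : ℝ) ≤ m by linarith)]
        have h2 : (1 - (1 - s) ^ N) / (4 * s) * (2 * ((m : ℝ) - 1) ^ 2 / ((m : ℝ) ^ 2 + 1)) =
            (1 - (1 - s) ^ N) * ((2 * ((m : ℝ) - 1) ^ 2 / ((m : ℝ) ^ 2 + 1)) / (4 * s)) := by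
          ring
        rw [h2]
        nlinarith

theorem exists_integral_one_sub_minorSum_pow_le : ∃ N : ℕ, 0 < N ∧ ∀ (m : ℕ) [NeZero m], 2 ≤ m →
    ∫ U, (1 - minorSum (haarVector (Fin m × Fin m) U) / 4) ^ N
      ∂haarUnitary (Fin m × Fin m) ≤ 1 / 2 := by
  obtain ⟨N, hN, h1, h2⟩ : ∃ N : ℕ, 0 < N ∧
      (∀ q : ℝ, 0 ≤ q → q ≤ 1 → (1 - q) ^ N ≤ (1 - 7 * q) ^ 2 + 1 / 5) ∧
      (2 / 3 : ℝ) ^ N ≤ 1 / 6 :=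
    ⟨64, by norm_num, fun q h0 h1 => one_sub_pow_le_quadratic h0 h1, by norm_num⟩
  refine ⟨N, hN, fun m _ hm => ?_⟩
  rcases hm.eq_or_lt with rfl | hm3
  · have h := integral_one_sub_minorSum_pow_le_fin_two h1
    convert h
  · exact integral_one_sub_minorSum_pow_le_of_two_lt h2 hm3

end SwapCompleteness

/-! ### Soundness of the SWAP test, and tuning to exact values -/

section Memory

variable {ι : Type} [Fintype ι] [DecidableEq ι]

theorem JointProtocol.continuous_detectProb {T : ℕ} (P : JointProtocol ι T) :
    Continuous P.detectProb := by
  have h : Continuous fun ρ : Matrix ι ι ℂ => tensorPower ρ T :=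
    continuous_matrix fun x y => show Continuous fun ρ : Matrix ι ι ℂ => ∏ t, ρ (x t) (y t) from
      continuous_finsetProd _ fun t _ => continuous_id.matrix_elem (x t) (y t)
  refine continuous_finsetSum _ fun o _ => ?_
  split_ifs
  · exact (P.povm.continuous_prob o).comp h
  · exact continuous_const

/-- Randomize a protocol: with probability `a` keep the verdict, with probability `b` declare
"entangled" regardless of the data. -/
theorem JointProtocol.exists_mix {T : ℕ} (P : JointProtocol ι T) {a b : ℝ} (ha : 0 ≤ a)
    (hb : 0 ≤ b) (hab : a + b ≤ 1) : ∃ Q : JointProtocol ι T, ∀ ρ : Matrix ι ι ℂ, IsDensity ρ →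
      Q.detectProb ρ = a * P.detectProb ρ + b := by
  set E : Matrix (Fin T → ι) (Fin T → ι) ℂ :=
    ∑ o, if P.estimator o < 0 then P.povm.effect o else 0 with hE
  set E' : Matrix (Fin T → ι) (Fin T → ι) ℂ :=
    ∑ o, if P.estimator o < 0 then 0 else P.povm.effect o with hE'
  have hsum : E + E' = 1 := by
    rw [hE, hE', ← Finset.sum_add_distrib, ← P.povm.sum_effect]
    exact Finset.sum_congr rfl fun o _ => by split_ifs <;> simp
  have hEp : E.PosSemidef := posSemidef_sum _ fun o _ => by
    split_ifs
    exacts [P.povm.posSemidef o, PosSemidef.zero]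
  have hEp' : E'.PosSemidef := posSemidef_sum _ fun o _ => by
    split_ifs
    exacts [PosSemidef.zero, P.povm.posSemidef o]
  have hcoe : ∀ {c : ℝ}, 0 ≤ c → (0 : ℂ) ≤ (c : ℂ) := fun h => by exact_mod_cast h
  -- The coin is built into the effects: E and E' are the two verdicts of P, and adding multiples of
  -- 1 realizes the verdicts given regardless of the data.
  let M : POVM (Fin T → ι) Bool :=
    { effect := fun o => bif o then (a : ℂ) • E + (b : ℂ) • 1
        else (a : ℂ) • E' + ((1 - a - b : ℝ) : ℂ) • 1
      posSemidef := by
        rintro (_ | _)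
        · exact (hEp'.smul (hcoe ha)).add (PosSemidef.one.smul (hcoe (by linarith)))
        · exact (hEp.smul (hcoe ha)).add (PosSemidef.one.smul (hcoe hb))
      sum_effect := by
        rw [Fintype.sum_bool]
        simp only [cond_true, cond_false]
        rw [← sub_eq_iff_eq_add'.mpr hsum.symm]
        push_cast
        module }
  refine ⟨{ Outcome := Bool, povm := M, estimator := fun o => bif o then -1 else 0 },
    fun ρ hρ => ?_⟩
  have htr : (tensorPower ρ T).trace = 1 := by rw [trace_tensorPower, hρ.2, one_pow]
  have hP : P.detectProb ρ = (E * tensorPower ρ T).trace.re := by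
    rw [hE, Finset.sum_mul, trace_sum, Complex.re_sum]
    exact Finset.sum_congr rfl fun o _ => by split_ifs <;> simp [POVM.prob]
  rw [hP]
  change (∑ o : Bool, if (bif o then (-1 : ℝ) else 0) < 0 then M.prob (tensorPower ρ T) o else 0) = _
  rw [Fintype.sum_bool]
  simp only [cond_true, cond_false, lt_irrefl, if_false, add_zero, POVM.prob, M]
  rw [if_pos (by norm_num), Matrix.add_mul, trace_add, Matrix.smul_mul, Matrix.smul_mul,
    Matrix.one_mul, trace_smul, trace_smul, htr, Complex.add_re, smul_eq_mul, smul_eq_mul,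
    Complex.re_ofReal_mul, mul_one, Complex.ofReal_re]

variable {m : ℕ} [NeZero m]

instance instIsProbabilityMeasureTaskLaw : IsProbabilityMeasure (taskLaw m) := by
  refine ⟨?_⟩
  simp [taskLaw, ENNReal.inv_two_add_inv_two]

theorem ae_haarState {p : Matrix ι ι ℂ → Prop} [Nonempty ι]
    (h : ∀ U, p (ketbra (haarVector ι U))) : ∀ᵐ ρ ∂haarState ι, p ρ := by
  set K := Set.range fun U => ketbra (haarVector ι U) with hK
  have hKm : MeasurableSet K := (isCompact_range
    (continuous_ketbra.comp (continuous_haarVector ι))).measurableSet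
  have : ∀ᵐ ρ ∂haarState ι, ρ ∈ K := by
    rw [haarState_eq_map]
    exact (ae_map_iff measurable_ketbra_haarVector.aemeasurable hKm).mpr
      (ae_of_all _ fun U => ⟨U, rfl⟩)
  filter_upwards [this] with ρ hρ
  obtain ⟨U, rfl⟩ := hρ
  exact h U

theorem ae_haarProductState {A B : Type} [Fintype A] [DecidableEq A] [Nonempty A] [Fintype B]
    [DecidableEq B] [Nonempty B] {p : Matrix (A × B) (A × B) ℂ → Prop}
    (h : ∀ U, p (ketbra (tensorVec (haarVectorPair A B U)))) : ∀ᵐ ρ ∂haarProductState A B, p ρ := by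
  set K := Set.range fun U => ketbra (tensorVec (haarVectorPair A B U)) with hK
  have hKm : MeasurableSet K := (isCompact_range continuous_ketbra_haarVectorPair).measurableSet
  have : ∀ᵐ ρ ∂haarProductState A B, ρ ∈ K := by
    rw [haarProductState_eq_map]
    exact (ae_map_iff measurable_ketbra_haarVectorPair.aemeasurable hKm).mpr
      (ae_of_all _ fun U => ⟨U, rfl⟩)
  filter_upwards [this] with ρ hρ
  obtain ⟨U, rfl⟩ := hρ
  exact h U

theorem ae_isDensity_taskLaw : ∀ᵐ ρ ∂taskLaw m, IsDensity ρ := by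
  rw [taskLaw, ae_add_measure_iff]
  exact ⟨Measure.ae_smul_measure (ae_haarState fun U =>
      isDensity_ketbra (sum_haarVector_mul_conj _ U)) _,
    Measure.ae_smul_measure (ae_haarProductState fun U =>
      isDensity_ketbra (sum_tensorVec_mul_conj U)) _⟩

theorem integrable_taskLaw {p : Matrix (Fin m × Fin m) (Fin m × Fin m) ℂ → ℝ}
    (hp : Continuous p) : Integrable p (taskLaw m) :=
  ((integrable_haarState hp).smul_measure (by simp)).add_measure
    ((integrable_haarProductState hp).smul_measure (by simp))

theorem measureReal_entangled_taskLaw_le :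
    (taskLaw m).real (entangled (Fin m) (Fin m)) ≤ 1 / 2 := by
  have h := setIntegral_entangled_taskLaw (m := m) (p := fun _ => 1)
  have h' := setIntegral_entangled_haarState_le (m := m) (p := fun _ => 1) continuous_const
    fun _ _ => zero_le_one
  simp only [setIntegral_const, smul_eq_mul, mul_one] at h h'
  simp only [integral_const, probReal_univ, smul_eq_mul, mul_one] at h'
  linarith

section Swap

variable {N : ℕ} (hN : 0 < N)

include hN

omit [NeZero m] in
theorem detectProb_swapTest_of_isSeparable {ψ : Fin m × Fin m → ℂ}
    (hψ : ∑ p, ψ p * conj (ψ p) = 1) (h : IsSeparable (ketbra ψ)) :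
    (swapTestProtocol (Fin m) (Fin m) N).detectProb (ketbra ψ) = 0 := by
  rw [detectProb_swapTestProtocol hN hψ, minorSum_eq_zero_of_isSeparable hψ h]
  simp

/-- No false alarms: both laws are carried by pure states, and a separable pure state has vanishing
minors. -/
theorem ae_detectProb_swapTest_eq_zero : ∀ᵐ ρ ∂taskLaw m, ρ ∉ entangled (Fin m) (Fin m) →
    (swapTestProtocol (Fin m) (Fin m) N).detectProb ρ = 0 := by
  have key : ∀ ψ : Fin m × Fin m → ℂ, ∑ p, ψ p * conj (ψ p) = 1 →
      ketbra ψ ∉ entangled (Fin m) (Fin m) →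
      (swapTestProtocol (Fin m) (Fin m) N).detectProb (ketbra ψ) = 0 := by
    intro ψ hψ h
    refine detectProb_swapTest_of_isSeparable hN hψ ?_
    by_contra hsep
    exact h ⟨isDensity_ketbra hψ, hsep⟩
  rw [taskLaw, ae_add_measure_iff]
  exact ⟨Measure.ae_smul_measure (ae_haarState fun U => key _ (sum_haarVector_mul_conj _ U)) _,
    Measure.ae_smul_measure (ae_haarProductState fun U => key _ (sum_tensorVec_mul_conj U)) _⟩

theorem setIntegral_entangled_swapTest :
    ∫ ρ in entangled (Fin m) (Fin m), (swapTestProtocol (Fin m) (Fin m) N).detectProb ρ ∂taskLaw m =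
      completeness (taskLaw m) (swapTestProtocol (Fin m) (Fin m) N).detectProb :=
  setIntegral_eq_integral_of_ae_compl_eq_zero (ae_detectProb_swapTest_eq_zero hN)

theorem completeness_swapTest :
    completeness (taskLaw m) (swapTestProtocol (Fin m) (Fin m) N).detectProb =
      (1 - ∫ U, (1 - minorSum (haarVector (Fin m × Fin m) U) / 4) ^ N
        ∂haarUnitary (Fin m × Fin m)) / 2 := by
  have hc := (swapTestProtocol (Fin m) (Fin m) N).continuous_detectProb
  rw [completeness_taskLaw hc, integral_haarState hc, integral_haarProductState hc]
  simp only [detectProb_swapTestProtocol hN (sum_haarVector_mul_conj _ _)]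
  rw [integral_sub (integrable_const _) (integrable_one_sub_minorSum_pow N)]
  have h0 : ∀ U, (swapTestProtocol (Fin m) (Fin m) N).detectProb
      (ketbra (tensorVec (haarVectorPair (Fin m) (Fin m) U))) = 0 := fun U => by
    refine detectProb_swapTest_of_isSeparable hN (sum_tensorVec_mul_conj U) ?_
    rw [ketbra_tensorVec]
    exact isSeparable_kronecker (isDensity_ketbra (sum_haarVector_mul_conj _ U.1))
      (isDensity_ketbra (sum_haarVector_mul_conj _ U.2))
  simp [h0]

end Swap

/-- The given protocol has no false alarms, so the excess is controlled by b alone: declaring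
"entangled" at random with probability b lowers the soundness, and a then adjusts the completeness.
-/
theorem exists_completeness_soundness_eq {T : ℕ} (P : JointProtocol (Fin m × Fin m) T)
    (hc : 1 / 4 ≤ completeness (taskLaw m) P.detectProb)
    (hent : ∫ ρ in entangled (Fin m) (Fin m), P.detectProb ρ ∂taskLaw m =
      completeness (taskLaw m) P.detectProb) :
    ∃ Q : JointProtocol (Fin m × Fin m) T, completeness (taskLaw m) Q.detectProb = 1 / 4 ∧
      soundness (taskLaw m) Q.detectProb = 5 / 6 := by
  set c := completeness (taskLaw m) P.detectProb with hcdef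
  set q := (taskLaw m).real (entangled (Fin m) (Fin m)) with hq
  have hq2 : q ≤ 1 / 2 := measureReal_entangled_taskLaw_le
  -- The target leaves a false alarm probability b(1 - q) = (1/4)(1/6) = 1/24. Since q ≤ 1/2, this
  -- gives b ≤ 1/12.
  set b : ℝ := 1 / (24 * (1 - q)) with hb
  have hb0 : 0 ≤ b := by
    rw [hb]
    exact div_nonneg zero_le_one (by linarith)
  have hbq : b * (1 - q) = 1 / 24 := by
    rw [hb]
    field_simp [show 1 - q ≠ 0 by linarith]
  have hb1 : b ≤ 1 / 12 := by nlinarith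
  set a : ℝ := (1 / 4 - b) / c with ha
  have hac : a * c = 1 / 4 - b := div_mul_cancel₀ _ (by linarith)
  have ha0 : 0 ≤ a := div_nonneg (by linarith) (by linarith)
  -- From c ≥ 1/4 one gets a ≤ 1 - 4b.
  have hab : a + b ≤ 1 := by nlinarith
  obtain ⟨Q, hQ⟩ := P.exists_mix ha0 hb0 hab
  have hae : Q.detectProb =ᵐ[taskLaw m] fun ρ => a * P.detectProb ρ + b := by
    filter_upwards [ae_isDensity_taskLaw] with ρ hρ using hQ ρ hρ
  have hi := integrable_taskLaw P.continuous_detectProb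
  have h1 : completeness (taskLaw m) Q.detectProb = 1 / 4 := by
    rw [completeness, integral_congr_ae hae,
      integral_add (hi.const_mul a) (integrable_const b), integral_const_mul]
    change a * c + _ = _
    simp [hac]
  have h2 : ∫ ρ in entangled (Fin m) (Fin m), Q.detectProb ρ ∂taskLaw m = 5 / 24 := by
    rw [integral_congr_ae (ae_restrict_of_ae hae),
      integral_add (hi.const_mul a).integrableOn (integrable_const b), integral_const_mul, hent,
      hac, setIntegral_const, smul_eq_mul, ← hq]
    linarith
  refine ⟨Q, h1, ?_⟩
  change (∫ ρ in entangled (Fin m) (Fin m), Q.detectProb ρ ∂taskLaw m) /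
    completeness (taskLaw m) Q.detectProb = 5 / 6
  rw [h1, h2]
  norm_num

end Memory

end EDP

/-! ### The main theorem -/

theorem mainTheorem5 :
    (∃ N : ℕ, ∀ (m : ℕ) [NeZero m], 2 ≤ m →
      (1 / 4 ≤ EDP.completeness (EDP.taskLaw m)
            (EDP.swapTestProtocol (Fin m) (Fin m) N).detectProb ∧
        5 / 6 ≤ EDP.soundness (EDP.taskLaw m)
            (EDP.swapTestProtocol (Fin m) (Fin m) N).detectProb) ∧
      ∃ P : EDP.JointProtocol (Fin m × Fin m) (N * 2),
        EDP.completeness (EDP.taskLaw m) P.detectProb = 1 / 4 ∧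
        EDP.soundness (EDP.taskLaw m) P.detectProb = 5 / 6) ∧
    (∃ c : ℝ, 0 < c ∧ ∀ (m : ℕ) [NeZero m], 2 ≤ m →
      ∀ (T : ℕ) (P : EDP.SingleCopyProtocol (Fin m × Fin m) T),
        1 / 4 ≤ EDP.completeness (EDP.taskLaw m) P.detectProb →
        5 / 6 ≤ EDP.soundness (EDP.taskLaw m) P.detectProb →
        c * ((m ^ 2 : ℕ) : ℝ) ^ (1 / 4 : ℝ) ≤ (T : ℝ)) := by
  constructor
  · obtain ⟨N, hN, hle⟩ := EDP.exists_integral_one_sub_minorSum_pow_le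
    refine ⟨N, fun m _ hm => ?_⟩
    have hc : 1 / 4 ≤ EDP.completeness (EDP.taskLaw m)
        (EDP.swapTestProtocol (Fin m) (Fin m) N).detectProb := by
      rw [EDP.completeness_swapTest hN]
      linarith [hle m hm]
    have hent := EDP.setIntegral_entangled_swapTest (m := m) hN
    refine ⟨⟨hc, ?_⟩, EDP.exists_completeness_soundness_eq _ hc hent⟩
    change 5 / 6 ≤ (∫ ρ in EDP.entangled (Fin m) (Fin m),
      (EDP.swapTestProtocol (Fin m) (Fin m) N).detectProb ρ ∂EDP.taskLaw m) /
      EDP.completeness (EDP.taskLaw m) (EDP.swapTestProtocol (Fin m) (Fin m) N).detectProb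
    -- The soundness of the SWAP test is exactly 1.
    rw [hent, div_self (by linarith)]
    norm_num
  -- The bound m ≤ 6T² ≤ (3T)² gives √m ≤ 3T, and √m = d^(1/4).
  · refine ⟨1 / 3, by norm_num, fun m _ hm T P hc hs => ?_⟩
    have h := EDP.le_sq_copies hm P hc hs
    have hroot : ((m ^ 2 : ℕ) : ℝ) ^ (1 / 4 : ℝ) = √m := by
      push_cast
      rw [← Real.rpow_natCast (m : ℝ) 2, ← Real.rpow_mul (Nat.cast_nonneg m), Real.sqrt_eq_rpow]
      norm_num
    rw [hroot]
    have h2 : √(m : ℝ) ≤ 3 * T := by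
      refine Real.sqrt_le_iff.mpr ⟨by positivity, ?_⟩
      nlinarith [sq_nonneg (T : ℝ)]
    linarith
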